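/- Let $(M,g,J)$ be a Hermitian manifold of complex dimension $n$ (not necessarily compact): $M$ is a complex manifold with complex structure $J$, and $g$ is a smooth Riemannian metric with $g(JX,JY)=g(X,Y)$. In local holomorphic coordinates put $h_{i\bar j}=g\left(\frac{\partial}{\partial z^i},\frac{\partial}{\partial \bar z^j}\right)$ (with $g$ extended $\mathbb C$-bilinearly), let $(h^{k\bar\ell})$ be given by $h^{k\bar\ell}h_{j\bar\ell}=\delta^k_j$, and let $\omega=\sqrt{-1}\,h_{i\bar j}\,dz^i\wedge d\bar z^j$ be the fundamental form, $\omega(X,Y)=g(JX,Y)$. Let $\nabla=\nabla^{\mathrm{Ch},\mathbb R}$ be the real Chern connection, i.e. the real connection on $T_{\mathbb R}M$ preserving $g$ and $J$ whose complexification restricts to the Chern connection of $(T^{1,0}M,h)$: $\nabla_{\partial/\partial z^i}\frac{\partial}{\partial z^j}=h^{k\bar\ell}\frac{\partial h_{j\bar\ell}}{\partial z^i}\frac{\partial}{\partial z^k}$ and $\nabla_{\partial/\partial\bar z^i}\frac{\partial}{\partial z^j}=0$. Its real Chern-Ricci curvature is $$\mathrm{Ric}(\nabla^{\mathrm{Ch},\mathbb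 R},g)(X,Y)=\sum_{a=1}^{2n}g\big(\nabla_X\nabla_{e_a}e_a-\nabla_{e_a}\nabla_Xe_a-\nabla_{[X,e_a]}e_a,\,Y\big)$$ for a local $g$-orthonormal frame $\{e_a\}$. It is called positive if it is symmetric and positive definite at every point, and $(\nabla^{\mathrm{Ch},\mathbb R},g)$ is called real Chern-Einstein with constant $\lambda\in\mathbb R$ if $\mathrm{Ric}(\nabla^{\mathrm{Ch},\mathbb R},g)=\lambda g$. Let $$\Theta_{i\bar jk\bar\ell}=-\frac{\partial^2h_{k\bar\ell}}{\partial z^i\partial\bar z^j}+h^{p\bar q}\frac{\partial h_{p\bar\ell}}{\partial\bar z^j}\frac{\partial h_{k\bar q}}{\partial z^i}$$ be the curvature of the Chern connection, let $\Theta^{(1)}=\sqrt{-1}\,h^{k\bar\ell}\Theta_{i\bar jk\bar\ell}\,dz^i\wedge d\bar z^j$ be its first Chern-Ricci curvature, and let $\partial^*$ be the formal $L^2$-adjoint of $\partial$ with respect to $g$. Theorem. $\mathrm{Ric}(\nabla^{\mathrm{Ch},\mathbb R},g)$ is positive if and only if $\Theta^{(1)}-\partial\partial^*\omega$ is a positive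 definite Hermitian $(1,1)$-form, that is, it equals $\sqrt{-1}A_{i\bar j}\,dz^i\wedge d\bar z^j$ with $(A_{i\bar j})$ Hermitian and positive definite at every point. Moreover, for every $\lambda\in\mathbb R$, $(\nabla^{\mathrm{Ch},\mathbb R},g)$ is real Chern-Einstein with constant $\lambda$ if and only if $$\Theta^{(1)}-\partial\partial^*\omega=\lambda\,\omega .$$ -/

import Mathlib

open scoped Manifold ContDiff ComplexOrder
open Bundle MeasureTheory

noncomputable section

namespace HermitianGeometry

/-! ### Complex manifolds and Hermitian metrics -/

/-- The model space `ℂⁿ` with holomorphic coordinates `z¹, …, zⁿ`. -/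
abbrev Cn (n : ℕ) : Type := EuclideanSpace ℂ (Fin n)

/-- A complex manifold of dimension `n` is in particular a smooth real manifold. -/
instance realManifold {n : ℕ} {M : Type*} [TopologicalSpace M] [ChartedSpace (Cn n) M]
    [IsManifold 𝓘(ℂ, Cn n) ω M] : IsManifold 𝓘(ℝ, Cn n) ∞ M := by
  refine isManifold_of_contDiffOn _ _ _ fun e e' he he' => ?_
  have h := (contDiffGroupoid ω 𝓘(ℂ, Cn n)).compatible he he'
  rw [contDiffGroupoid, mem_groupoid_of_pregroupoid] at h
  exact (h.1.restrict_scalars ℝ).of_le (by simp)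

/-- The real tangent space `T_x M` of the complex manifold `M`. -/
abbrev RealTangent (n : ℕ) {M : Type*} [TopologicalSpace M] [ChartedSpace (Cn n) M] (x : M) :
    Type :=
  TangentSpace 𝓘(ℝ, Cn n) x

/-- A smooth Riemannian metric on the smooth real manifold underlying `M`. -/
abbrev SmoothMetric (n : ℕ) (M : Type*) [TopologicalSpace M] [ChartedSpace (Cn n) M]
    [IsManifold 𝓘(ℂ, Cn n) ω M] : Type _ :=
  ContMDiffRiemannianMetric 𝓘(ℝ, Cn n) ∞ (Cn n) (TangentSpace 𝓘(ℝ, Cn n) : M → Type)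

/-- The complex structure `J` of `M`. The tangent space is identified with `ℂⁿ` by a holomorphic
chart, and `J` is multiplication by `√-1`. -/
def complexStructure {n : ℕ} {M : Type*} [TopologicalSpace M] [ChartedSpace (Cn n) M] (x : M) :
    RealTangent n x →L[ℝ] RealTangent n x :=
  (Complex.I • ContinuousLinearMap.id ℝ (Cn n) : Cn n →L[ℝ] Cn n)

/-- The metric is compatible with `J`, that is, `g (J X, J Y) = g (X, Y)`. -/
def IsHermitianMetric {n : ℕ} {M : Type*} [TopologicalSpace M] [ChartedSpace (Cn n) M]
    [IsManifold 𝓘(ℂ, Cn n) ω M] (g : SmoothMetric n M) : Prop :=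
  ∀ (x : M) (X Y : RealTangent n x),
    g.inner x (complexStructure x X) (complexStructure x Y) = g.inner x X Y

/-- The metric in the coordinates given by a chart `e`: the pullback of `g` by `e⁻¹`. -/
def chartMetric {n : ℕ} {M : Type*} [TopologicalSpace M] [ChartedSpace (Cn n) M]
    [IsManifold 𝓘(ℂ, Cn n) ω M] (g : SmoothMetric n M) (e : OpenPartialHomeomorph M (Cn n))
    (z v w : Cn n) : ℝ :=
  g.inner (e.symm z) (mfderiv 𝓘(ℝ, Cn n) 𝓘(ℝ, Cn n) e.symm z v)
    (mfderiv 𝓘(ℝ, Cn n) 𝓘(ℝ, Cn n) e.symm z w)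

/-! ### Hermitian geometry in holomorphic coordinates

Here `G z v w` is a metric on a domain of `ℂⁿ`. A real tangent vector is written as the vector
`v ∈ ℂⁿ` of its complex components: it is `∑ vⁱ ∂/∂zⁱ + conj (vⁱ) ∂/∂z̄ⁱ`. -/

section Local

variable {n : ℕ}

/-- The real coordinate vector `∂/∂xⁱ`. -/
def ex (i : Fin n) : Cn n := EuclideanSpace.single i 1

/-- The real coordinate vector `J ∂/∂xⁱ`. -/
def ey (i : Fin n) : Cn n := EuclideanSpace.single i Complex.I

/-- The Wirtinger derivative `∂f/∂zⁱ`. -/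
def dz (i : Fin n) (f : Cn n → ℂ) (z : Cn n) : ℂ :=
  (fderiv ℝ f z (ex i) - Complex.I * fderiv ℝ f z (ey i)) / 2

/-- The Wirtinger derivative `∂f/∂z̄ⁱ`. -/
def dzbar (i : Fin n) (f : Cn n → ℂ) (z : Cn n) : ℂ :=
  (fderiv ℝ f z (ex i) + Complex.I * fderiv ℝ f z (ey i)) / 2

/-- The matrix `h_{i j̄} = g(∂/∂zⁱ, ∂/∂z̄ʲ)`, where `g` is extended complex bilinearly,
`∂/∂zⁱ = (∂/∂xⁱ - √-1 J ∂/∂xⁱ) / 2` and `∂/∂z̄ʲ = (∂/∂xʲ + √-1 J ∂/∂xʲ) / 2`. -/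
def hMatrix (G : Cn n → Cn n → Cn n → ℝ) (z : Cn n) : Matrix (Fin n) (Fin n) ℂ :=
  Matrix.of fun i j =>
    ((G z (ex i) (ex j) : ℂ) + Complex.I * G z (ex i) (ey j)
      - Complex.I * G z (ey i) (ex j) + G z (ey i) (ey j)) / 4

/-- `hInv G z k l` is `h^{k l̄}`, normalised by `∑_l h^{k l̄} h_{j l̄} = δ_{jk}`. -/
def hInv (G : Cn n → Cn n → Cn n → ℝ) (z : Cn n) (k l : Fin n) : ℂ :=
  (hMatrix G z)⁻¹ l k

/-- The coefficients `Γ_{ij}^k = h^{k l̄} ∂h_{j l̄}/∂zⁱ` of the Chern connection on `T^{1,0}M`: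
`∇_{∂/∂zⁱ} ∂/∂zʲ = Γ_{ij}^k ∂/∂zᵏ` and `∇_{∂/∂z̄ⁱ} ∂/∂zʲ = 0`. -/
def chernGamma (G : Cn n → Cn n → Cn n → ℝ) (z : Cn n) (i j k : Fin n) : ℂ :=
  ∑ l, hInv G z k l * dz i (fun y => hMatrix G y j l) z

/-- The real Chern connection `∇_X Y`, the real connection on `T_ℝ M` whose complexification
restricts to the Chern connection on `T^{1,0}M`. In complex components,
`(∇_X Y)ᵏ = X(Yᵏ) + Γ_{ij}^k Xⁱ Yʲ`. -/
def realChern (G : Cn n → Cn n → Cn n → ℝ) (X Y : Cn n → Cn n) (z : Cn n) : Cn n :=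
  fderiv ℝ Y z (X z) +
    WithLp.toLp 2 fun k => ∑ i, ∑ j, chernGamma G z i j k * X z i * Y z j

/-- The curvature `∇_X ∇_Y Z - ∇_Y ∇_X Z - ∇_{[X, Y]} Z` of the real Chern connection. -/
def realChernCurvatureField (G : Cn n → Cn n → Cn n → ℝ) (X Y Z : Cn n → Cn n) (z : Cn n) :
    Cn n :=
  realChern G X (realChern G Y Z) z - realChern G Y (realChern G X Z) z
    - realChern G (VectorField.lieBracket ℝ X Y) Z z

/-- The value on tangent vectors of the (tensorial) curvature: the vectors are extended as vector
fields with constant coefficients. -/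
def realChernCurvature (G : Cn n → Cn n → Cn n → ℝ) (z u v w : Cn n) : Cn n :=
  realChernCurvatureField G (fun _ => u) (fun _ => v) (fun _ => w) z

/-- The curvature of the Chern connection,
`Θ_{i j̄ k l̄} = - ∂²h_{k l̄}/∂zⁱ∂z̄ʲ + h^{p q̄} ∂h_{p l̄}/∂z̄ʲ ∂h_{k q̄}/∂zⁱ`. -/
def chernTheta (G : Cn n → Cn n → Cn n → ℝ) (z : Cn n) (i j k l : Fin n) : ℂ :=
  - dz i (fun y => dzbar j (fun y' => hMatrix G y' k l) y) z
    + ∑ p, ∑ q, hInv G z p q * dzbar j (fun y => hMatrix G y p l) z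
        * dz i (fun y => hMatrix G y k q) z

/-! A form of type `(1,1)` is represented by the matrix `β_{i j̄}` with
`β = β_{i j̄} dzⁱ ∧ dz̄ʲ`, and a form of type `(0,1)` by the vector `α_{j̄}` with
`α = α_{j̄} dz̄ʲ`. -/

/-- The fundamental form `ω = √-1 h_{i j̄} dzⁱ ∧ dz̄ʲ`. -/
def omegaForm (G : Cn n → Cn n → Cn n → ℝ) (z : Cn n) : Matrix (Fin n) (Fin n) ℂ :=
  Complex.I • hMatrix G z

/-- The first Chern-Ricci curvature `Θ⁽¹⁾ = √-1 h^{k l̄} Θ_{i j̄ k l̄} dzⁱ ∧ dz̄ʲ`. -/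
def thetaOne (G : Cn n → Cn n → Cn n → ℝ) (z : Cn n) : Matrix (Fin n) (Fin n) ℂ :=
  Matrix.of fun i j => Complex.I * ∑ k, ∑ l, hInv G z k l * chernTheta G z i j k l

/-- The operator `∂` on forms of type `(0,1)`:
`∂(α_{j̄} dz̄ʲ) = ∂α_{j̄}/∂zⁱ dzⁱ ∧ dz̄ʲ`. -/
def del (α : Cn n → Fin n → ℂ) (z : Cn n) : Matrix (Fin n) (Fin n) ℂ :=
  Matrix.of fun i j => dz i (fun y => α y j) z

/-- The pointwise Hermitian product `⟨α, η⟩ = h^{l j̄} α_{j̄} conj (η_{l̄})` of `(0,1)`-forms. -/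
def inner01 (G : Cn n → Cn n → Cn n → ℝ) (z : Cn n) (α η : Fin n → ℂ) : ℂ :=
  ∑ j, ∑ l, hInv G z l j * α j * star (η l)

/-- The pointwise Hermitian product
`⟨β, γ⟩ = h^{i k̄} h^{l j̄} β_{i j̄} conj (γ_{k l̄})` of `(1,1)`-forms. -/
def inner11 (G : Cn n → Cn n → Cn n → ℝ) (z : Cn n) (β γ : Matrix (Fin n) (Fin n) ℂ) : ℂ :=
  ∑ i, ∑ j, ∑ k, ∑ l, hInv G z i k * hInv G z l j * β i j * star (γ k l)

/-- The density of the Riemannian volume `ωⁿ / n!` with respect to Lebesgue measure. -/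
def volDensity (G : Cn n → Cn n → Cn n → ℝ) (z : Cn n) : ℂ :=
  2 ^ n * (hMatrix G z).det

/-- The `(0,1)`-form `α` is `∂^* β` on the open set `U`: it is smooth, and
`(α, η) = (β, ∂η)` in `L²` for every smooth `(0,1)`-form `η` with compact support in `U`. -/
def IsDelStar (U : Set (Cn n)) (G : Cn n → Cn n → Cn n → ℝ)
    (β : Cn n → Matrix (Fin n) (Fin n) ℂ) (α : Cn n → Fin n → ℂ) : Prop :=
  ContDiffOn ℝ ∞ α U ∧
    ∀ η : Cn n → Fin n → ℂ, ContDiff ℝ ∞ η → HasCompactSupport η → tsupport η ⊆ U →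
      ∫ z in U, inner01 G z (α z) (η z) * volDensity G z =
        ∫ z in U, inner11 G z (β z) (del η z) * volDensity G z

open Classical in
/-- The form `∂^* β` on `U`, where `∂^*` is the formal adjoint of `∂`. For a smooth metric and a
smooth form it exists and its values on `U` are uniquely determined. -/
def delStar (U : Set (Cn n)) (G : Cn n → Cn n → Cn n → ℝ)
    (β : Cn n → Matrix (Fin n) (Fin n) ℂ) : Cn n → Fin n → ℂ :=
  if h : ∃ α, IsDelStar U G β α then h.choose else 0

end Local

/-! ### The global tensors and the curvature conditions -/

section Global

variable {n : ℕ} {M : Type*} [TopologicalSpace M] [ChartedSpace (Cn n) M]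
  [IsManifold 𝓘(ℂ, Cn n) ω M]

theorem exists_orthonormalFrame (g : SmoothMetric n M) (x : M) :
    ∃ b : Module.Basis (Fin (2 * n)) ℝ (RealTangent n x),
      ∀ a c, g.inner x (b a) (b c) = if a = c then 1 else 0 := by
  let _ : RiemannianBundle (TangentSpace 𝓘(ℝ, Cn n) : M → Type) := ⟨g.toRiemannianMetric⟩
  have : FiniteDimensional ℝ (RealTangent n x) :=
    inferInstanceAs (FiniteDimensional ℝ (Cn n))
  have hd : Module.finrank ℝ (RealTangent n x) = 2 * n := by
    change Module.finrank ℝ (Cn n) = 2 * n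
    rw [← Module.finrank_mul_finrank ℝ ℂ (Cn n)]
    simp
  let b := (stdOrthonormalBasis ℝ (RealTangent n x)).reindex (finCongr hd)
  exact ⟨b.toBasis, fun a c => by simpa using! orthonormal_iff_ite.mp b.orthonormal a c⟩

/-- An orthonormal basis `e₁, …, e_{2n}` of `(T_x M, g)`. -/
def orthonormalFrame (g : SmoothMetric n M) (x : M) :
    Module.Basis (Fin (2 * n)) ℝ (RealTangent n x) :=
  (exists_orthonormalFrame g x).choose

/-- The curvature tensor `R(X, Y, Z, W) = g(R(X, Y) Z, W)` of the real Chern connection at `x`,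
computed in the holomorphic chart at `x`, which is also used to identify `T_x M` with `ℂⁿ`. -/
def realChernTensor (g : SmoothMetric n M) (x : M) (X Y Z W : RealTangent n x) : ℝ :=
  g.inner x
    (realChernCurvature (chartMetric g (chartAt (Cn n) x)) (chartAt (Cn n) x x) X Y Z :
      Cn n) W

/-- The real Chern-Ricci curvature `Ric(X, Y) = ∑ᵢ R(X, eᵢ, eᵢ, Y)`. -/
def realChernRicci (g : SmoothMetric n M) (x : M) (X Y : RealTangent n x) : ℝ :=
  ∑ a, realChernTensor g x X (orthonormalFrame g x a) (orthonormalFrame g x a) Y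

/-- The real Chern-Ricci curvature is positive: it is symmetric and positive definite. -/
def HasPositiveRealChernRicci (g : SmoothMetric n M) : Prop :=
  (∀ (x : M) (X Y : RealTangent n x), realChernRicci g x X Y = realChernRicci g x Y X) ∧
    ∀ (x : M) (X : RealTangent n x), X ≠ 0 → 0 < realChernRicci g x X X

/-- The metric is real Chern-Einstein with constant `lam`, that is, `Ric = lam g`. -/
def IsRealChernEinstein (g : SmoothMetric n M) (lam : ℝ) : Prop :=
  ∀ (x : M) (X Y : RealTangent n x), realChernRicci g x X Y = lam * g.inner x X Y

/-- The form `ω` at `x`, by its coefficients in the holomorphic chart at `x`. -/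
def fundamentalForm (g : SmoothMetric n M) (x : M) : Matrix (Fin n) (Fin n) ℂ :=
  omegaForm (chartMetric g (chartAt (Cn n) x)) (chartAt (Cn n) x x)

/-- The form `Θ⁽¹⁾` at `x`, by its coefficients in the holomorphic chart at `x`. -/
def firstChernRicci (g : SmoothMetric n M) (x : M) : Matrix (Fin n) (Fin n) ℂ :=
  thetaOne (chartMetric g (chartAt (Cn n) x)) (chartAt (Cn n) x x)

/-- The form `∂∂^*ω` at `x`, by its coefficients in the holomorphic chart at `x`. -/
def delDelStarOmega (g : SmoothMetric n M) (x : M) : Matrix (Fin n) (Fin n) ℂ :=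
  del (delStar (chartAt (Cn n) x).target (chartMetric g (chartAt (Cn n) x))
    (omegaForm (chartMetric g (chartAt (Cn n) x)))) (chartAt (Cn n) x x)

/-- The form `β = √-1 A_{i j̄} dzⁱ ∧ dz̄ʲ` is a positive definite Hermitian `(1,1)`-form: at every
point, the matrix `A = -√-1 β` is Hermitian and positive definite. -/
def IsPositiveForm (β : M → Matrix (Fin n) (Fin n) ℂ) : Prop :=
  ∀ x, (-Complex.I • β x).PosDef

end Global

end HermitianGeometry

end

/-! Both sides of each equivalence are governed at every point by one matrix, `ricciMatrix`:
$S_{i\bar l} = h^{k\bar j}\Theta_{i\bar jk\bar l}$.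

Curvature side. In coordinates the quadratic and second-order terms of $\nabla\nabla$ cancel under
antisymmetrization, so the curvature of the real Chern connection has only a $(1,1)$ part, with
coefficients $X^i\overline{Y^j} - Y^i\overline{X^j}$ against $\Theta_{i\bar j}$
(`realChernCurvature_apply`). An orthonormal frame satisfies $\sum_a e_a^k\overline{e_a^j} =
h^{k\bar j}$ and $\sum_a e_a^i e_a^k = 0$ (`sum_orthonormal`). Hence tracing kills one of the two
terms and leaves $\mathrm{Ric}(X,Y) = 2\,\mathrm{Re}(S_{i\bar l}X^i\overline{Y^l})$.

Form side. Integration by parts and Jacobi's formula give $\partial^*\omega$ as an explicit trace of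
the torsion (`isDelStar_delStarOmega`). Since `delStar` is defined by choice, uniqueness of the
adjoint on the chart domain (`eqOn_of_isDelStar`) is needed as well. Applying $\partial$ gives
$\sqrt{-1}\,h^{k\bar l}(\Theta_{i\bar jk\bar l} - \Theta_{i\bar lk\bar j})$; subtracting this from
$\Theta^{(1)}$ leaves exactly $\sqrt{-1}\,S$ (`thetaOne_sub_del_delStarOmega`).

It remains to compare $S$ with its real bilinear form `sesqRe`: the correspondence is injective,
symmetric forms match Hermitian matrices, positive forms match positive definite ones, and $g$
itself corresponds to $h$. A holomorphic chart carries this to $M$, because its inverse commutes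
with $J$ and has identity differential at the base point. -/

noncomputable section

namespace HermitianGeometry

open Matrix

/-! ### Wirtinger derivatives -/

section Wirtinger

variable {n : ℕ}

/-- The derivative `(∂f/∂xⁱ + c ∂f/∂yⁱ) / 2`; it is `∂f/∂zⁱ` for `c = -√-1` and `∂f/∂z̄ⁱ` for
`c = √-1`. -/
def wirtinger (c : ℂ) (i : Fin n) (f : Cn n → ℂ) (z : Cn n) : ℂ :=
  (fderiv ℝ f z (ex i) + c * fderiv ℝ f z (ey i)) / 2

theorem dz_eq_wirtinger (i : Fin n) (f : Cn n → ℂ) : dz i f = wirtinger (-Complex.I) i f := by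
  funext z; simp [dz, wirtinger, sub_eq_add_neg]

theorem dzbar_eq_wirtinger (i : Fin n) (f : Cn n → ℂ) :
    dzbar i f = wirtinger Complex.I i f := rfl

theorem wirtinger_congr {c : ℂ} {i : Fin n} {f g : Cn n → ℂ} {z : Cn n}
    (h : f =ᶠ[nhds z] g) : wirtinger c i f z = wirtinger c i g z := by
  simp only [wirtinger, h.fderiv_eq]

theorem wirtinger_const (c : ℂ) (i : Fin n) (a : ℂ) (z : Cn n) :
    wirtinger c i (fun _ => a) z = 0 := by
  simp [wirtinger]

theorem wirtinger_add {c : ℂ} {i : Fin n} {f g : Cn n → ℂ} {z : Cn n}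
    (hf : DifferentiableAt ℝ f z) (hg : DifferentiableAt ℝ g z) :
    wirtinger c i (fun y => f y + g y) z = wirtinger c i f z + wirtinger c i g z := by
  simp only [wirtinger, fderiv_fun_add hf hg, _root_.add_apply]
  ring

theorem wirtinger_sub {c : ℂ} {i : Fin n} {f g : Cn n → ℂ} {z : Cn n}
    (hf : DifferentiableAt ℝ f z) (hg : DifferentiableAt ℝ g z) :
    wirtinger c i (fun y => f y - g y) z = wirtinger c i f z - wirtinger c i g z := by
  simp only [wirtinger, fderiv_fun_sub hf hg, _root_.sub_apply]
  ring

theorem wirtinger_mul {c : ℂ} {i : Fin n} {f g : Cn n → ℂ} {z : Cn n}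
    (hf : DifferentiableAt ℝ f z) (hg : DifferentiableAt ℝ g z) :
    wirtinger c i (fun y => f y * g y) z
      = wirtinger c i f z * g z + f z * wirtinger c i g z := by
  simp only [wirtinger, fderiv_fun_mul hf hg, _root_.add_apply,
    _root_.smul_apply, smul_eq_mul]
  ring

theorem wirtinger_const_mul {c : ℂ} {i : Fin n} (a : ℂ) {f : Cn n → ℂ} {z : Cn n}
    (hf : DifferentiableAt ℝ f z) :
    wirtinger c i (fun y => a * f y) z = a * wirtinger c i f z := by
  rw [wirtinger_mul (differentiableAt_const a) hf, wirtinger_const, zero_mul, zero_add]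

theorem wirtinger_sum {ι : Type*} {c : ℂ} {i : Fin n} (s : Finset ι) {f : ι → Cn n → ℂ}
    {z : Cn n} (hf : ∀ k ∈ s, DifferentiableAt ℝ (f k) z) :
    wirtinger c i (fun y => ∑ k ∈ s, f k y) z = ∑ k ∈ s, wirtinger c i (f k) z := by
  simp only [wirtinger, fderiv_fun_sum hf, _root_.sum_apply]
  rw [Finset.mul_sum, ← Finset.sum_add_distrib, Finset.sum_div]

theorem dzbar_star (i : Fin n) {f : Cn n → ℂ} {z : Cn n} (hf : DifferentiableAt ℝ f z) :
    dzbar i (fun y => star (f y)) z = star (dz i f z) := by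
  have h := (hf.hasFDerivAt.star).fderiv
  simp only [dzbar, dz, h]
  simp

theorem contDiffOn_wirtinger {c : ℂ} {i : Fin n} {f : Cn n → ℂ} {U : Set (Cn n)}
    (hU : IsOpen U) (hf : ContDiffOn ℝ ∞ f U) : ContDiffOn ℝ ∞ (wirtinger c i f) U := by
  have h : ContDiffOn ℝ ∞ (fderiv ℝ f) U := hf.fderiv_of_isOpen hU (by simp)
  unfold wirtinger
  fun_prop

/-- Symmetry of the second real derivative, whose values on `ex`, `ey` both sides combine
bilinearly. Arbitrary `c`, `d` cover $\partial\partial$ and $\partial\bar\partial$ at once. -/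
theorem wirtinger_comm {c d : ℂ} {i j : Fin n} {f : Cn n → ℂ} {U : Set (Cn n)}
    (hU : IsOpen U) (hf : ContDiffOn ℝ ∞ f U) {z : Cn n} (hz : z ∈ U) :
    wirtinger c i (wirtinger d j f) z = wirtinger d j (wirtinger c i f) z := by
  have h2 : DifferentiableAt ℝ (fderiv ℝ f) z :=
    ((hf.fderiv_of_isOpen hU (m := ∞) (by simp)).contDiffAt
      (hU.mem_nhds hz)).differentiableAt (by simp)
  have hs : IsSymmSndFDerivAt ℝ f z :=
    (hf.contDiffAt (hU.mem_nhds hz)).isSymmSndFDerivAt (by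
      rw [minSmoothness_of_isRCLikeNormedField]; exact WithTop.coe_le_coe.2 (le_top : (2 : ℕ∞) ≤ ⊤))
  have key : ∀ (c d : ℂ) (i j : Fin n), wirtinger c i (wirtinger d j f) z =
      ((fderiv ℝ (fderiv ℝ f) z (ex i) (ex j) + d * fderiv ℝ (fderiv ℝ f) z (ex i) (ey j)) +
        c * (fderiv ℝ (fderiv ℝ f) z (ey i) (ex j)
          + d * fderiv ℝ (fderiv ℝ f) z (ey i) (ey j))) / 4 := by
    intro c d i j
    have h3 : ∀ u : Cn n, HasFDerivAt (fun y => fderiv ℝ f y u)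
        ((ContinuousLinearMap.apply ℝ ℂ u).comp (fderiv ℝ (fderiv ℝ f) z)) z := fun u =>
      ((ContinuousLinearMap.apply ℝ ℂ u).hasFDerivAt).comp z h2.hasFDerivAt
    have e : wirtinger d j f = fun y =>
        (1 / 2) * (fderiv ℝ f y (ex j) + d * fderiv ℝ f y (ey j)) := by
      funext y; simp only [wirtinger]; ring
    rw [e, wirtinger_const_mul _
        ((h3 _).differentiableAt.fun_add ((h3 _).differentiableAt.const_mul d)),
      wirtinger_add (h3 _).differentiableAt ((h3 _).differentiableAt.const_mul d),
      wirtinger_const_mul _ (h3 _).differentiableAt]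
    simp only [wirtinger, (h3 _).fderiv]
    simp only [ContinuousLinearMap.comp_apply, ContinuousLinearMap.apply_apply]
    ring
  rw [key, key, hs.eq (ex i) (ex j), hs.eq (ex i) (ey j), hs.eq (ey i) (ex j),
    hs.eq (ey i) (ey j)]
  ring

theorem eq_sum_ex_ey (u : Cn n) :
    u = ∑ i, ((u i).re • ex i + (u i).im • ey i) := by
  ext j
  simp only [WithLp.ofLp_sum, WithLp.ofLp_add, WithLp.ofLp_smul, Finset.sum_apply, Pi.add_apply,
    Pi.smul_apply, ex, ey, PiLp.single_apply, Complex.real_smul]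
  rw [Finset.sum_eq_single j]
  · simp [Complex.re_add_im]
  · intro i _ hij; simp [hij.symm]
  · simp

/-- The splitting $df = \partial f + \bar\partial f$. In the curvature computation the conjugated
half is the source of $\Theta$. -/
theorem fderiv_apply_eq_sum (f : Cn n → ℂ) (z u : Cn n) :
    fderiv ℝ f z u = ∑ i, (u i * dz i f z + star (u i) * dzbar i f z) := by
  conv_lhs => rw [eq_sum_ex_ey u]
  rw [map_sum]
  refine Finset.sum_congr rfl fun i _ => ?_
  rw [map_add, map_smul, map_smul, Complex.real_smul, Complex.real_smul]
  conv_rhs => rw [← Complex.re_add_im (u i)]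
  simp only [dz, dzbar, star_add, star_mul', Complex.star_def, Complex.conj_ofReal, Complex.conj_I]
  linear_combination ((u i).im * fderiv ℝ f z (ey i)) * Complex.I_sq

/-! ### Wirtinger derivatives of matrices -/

/-- The entrywise Wirtinger derivative of a matrix of functions. -/
def mwirtinger (c : ℂ) (i : Fin n) (A : Cn n → Matrix (Fin n) (Fin n) ℂ) (z : Cn n) :
    Matrix (Fin n) (Fin n) ℂ :=
  Matrix.of fun k l => wirtinger c i (fun y => A y k l) z

/-- The entries of the matrix are smooth functions on `U`. -/
def SmoothEntries (U : Set (Cn n)) (A : Cn n → Matrix (Fin n) (Fin n) ℂ) : Prop :=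
  ∀ k l, ContDiffOn ℝ ∞ (fun z => A z k l) U

variable {U : Set (Cn n)} {A B : Cn n → Matrix (Fin n) (Fin n) ℂ}

theorem SmoothEntries.differentiableAt (hA : SmoothEntries U A) (hU : IsOpen U) {z : Cn n}
    (hz : z ∈ U) (k l : Fin n) : DifferentiableAt ℝ (fun y => A y k l) z :=
  ((hA k l).contDiffAt (hU.mem_nhds hz)).differentiableAt (by simp)

theorem SmoothEntries.mwirtinger (hA : SmoothEntries U A) (hU : IsOpen U) (c : ℂ) (i : Fin n) :
    SmoothEntries U (mwirtinger c i A) := fun k l => contDiffOn_wirtinger hU (hA k l)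

theorem SmoothEntries.mul (hA : SmoothEntries U A) (hB : SmoothEntries U B) :
    SmoothEntries U (fun z => A z * B z) := fun k l => by
  simp only [Matrix.mul_apply]
  exact ContDiffOn.sum fun p _ => (hA k p).mul (hB p l)

theorem SmoothEntries.det (hA : SmoothEntries U A) : ContDiffOn ℝ ∞ (fun z => (A z).det) U := by
  simp only [Matrix.det_apply']
  exact ContDiffOn.sum fun s _ => contDiffOn_const.mul (contDiffOn_prod fun i _ => hA _ _)

theorem SmoothEntries.inv (hA : SmoothEntries U A) (h : ∀ z ∈ U, IsUnit (A z).det) :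
    SmoothEntries U (fun z => (A z)⁻¹) := fun k l => by
  simp only [Matrix.inv_def, Matrix.smul_apply, Matrix.adjugate_apply, smul_eq_mul,
    Ring.inverse_eq_inv']
  refine (hA.det.inv fun z hz => (h z hz).ne_zero).mul ?_
  -- An adjugate entry is itself the determinant of a matrix with smooth entries.
  refine SmoothEntries.det (A := fun z => (A z).updateRow l (Pi.single k 1)) fun p q => ?_
  simp only [Matrix.updateRow_apply]
  split_ifs
  · exact contDiffOn_const
  · exact hA p q

theorem mwirtinger_congr {c : ℂ} {i : Fin n} {z : Cn n} (h : A =ᶠ[nhds z] B) :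
    mwirtinger c i A z = mwirtinger c i B z := by
  ext k l
  exact wirtinger_congr (h.mono fun y hy => by simp only [hy])

theorem mwirtinger_mul {c : ℂ} {i : Fin n} {z : Cn n} (hU : IsOpen U) (hz : z ∈ U)
    (hA : SmoothEntries U A) (hB : SmoothEntries U B) :
    mwirtinger c i (fun y => A y * B y) z
      = mwirtinger c i A z * B z + A z * mwirtinger c i B z := by
  ext k l
  have hA' := hA.differentiableAt hU hz
  have hB' := hB.differentiableAt hU hz
  simp only [mwirtinger, Matrix.of_apply, Matrix.add_apply, Matrix.mul_apply]
  rw [wirtinger_sum _ fun p _ => (hA' k p).fun_mul (hB' p l), ← Finset.sum_add_distrib]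
  exact Finset.sum_congr rfl fun p _ => wirtinger_mul (hA' k p) (hB' p l)

theorem mwirtinger_comm {c d : ℂ} {i j : Fin n} {z : Cn n} (hU : IsOpen U) (hz : z ∈ U)
    (hA : SmoothEntries U A) :
    mwirtinger c i (mwirtinger d j A) z = mwirtinger d j (mwirtinger c i A) z := by
  ext k l
  exact wirtinger_comm hU (hA k l) hz

/-- Differentiate $A A^{-1} = 1$, which holds on a neighbourhood of `z`, and multiply by $A^{-1}$ on
the left. -/
theorem mwirtinger_inv {c : ℂ} {i : Fin n} {z : Cn n} (hU : IsOpen U) (hz : z ∈ U)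
    (hA : SmoothEntries U A) (h : ∀ z ∈ U, IsUnit (A z).det) :
    mwirtinger c i (fun y => (A y)⁻¹) z = -((A z)⁻¹ * mwirtinger c i A z * (A z)⁻¹) := by
  have h1 := mwirtinger_mul (c := c) (i := i) hU hz hA (hA.inv h)
  have h2 : mwirtinger c i (fun y => A y * (A y)⁻¹) z = 0 := by
    rw [mwirtinger_congr (B := fun _ => 1)
      (Filter.eventually_of_mem (hU.mem_nhds hz) fun y hy => Matrix.mul_nonsing_inv _ (h y hy))]
    ext k l
    exact wirtinger_const c i _ z
  rw [h2] at h1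
  have h3 := congrArg (fun N => (A z)⁻¹ * N) h1
  simp only [Matrix.mul_zero, Matrix.mul_add, ← Matrix.mul_assoc,
    Matrix.nonsing_inv_mul _ (h z hz), Matrix.one_mul] at h3
  exact eq_neg_of_add_eq_zero_right h3.symm

/-- Jacobi's formula. By Cramer's rule each diagonal entry on the right is the determinant with one
column replaced by its derivative; summed over columns, this is the Leibniz expansion differentiated
factor by factor. -/
theorem wirtinger_det {c : ℂ} {i : Fin n} {z : Cn n} (hU : IsOpen U) (hz : z ∈ U)
    (hA : SmoothEntries U A) :
    wirtinger c i (fun y => (A y).det) z = ((A z).adjugate * mwirtinger c i A z).trace := by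
  have hA' := hA.differentiableAt hU hz
  have hp : ∀ s : Equiv.Perm (Fin n),
      HasFDerivAt (fun y => ∏ k, A y (s k) k)
        (∑ k, (∏ j ∈ Finset.univ.erase k, A z (s j) j) • fderiv ℝ (fun y => A y (s k) k) z) z :=
    fun s => HasFDerivAt.finsetProd fun k _ => (hA' (s k) k).hasFDerivAt
  have hw : ∀ s : Equiv.Perm (Fin n), wirtinger c i (fun y => ∏ k, A y (s k) k) z =
      ∑ k, mwirtinger c i A z (s k) k * ∏ j ∈ Finset.univ.erase k, A z (s j) j := by
    intro s
    simp only [wirtinger, mwirtinger, (hp s).fderiv, _root_.sum_apply,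
      _root_.smul_apply, smul_eq_mul, Matrix.of_apply]
    rw [Finset.mul_sum, ← Finset.sum_add_distrib, Finset.sum_div]
    exact Finset.sum_congr rfl fun k _ => by ring
  have hc : ∀ k, ((A z).adjugate * mwirtinger c i A z) k k
      = ((A z).updateCol k fun l => mwirtinger c i A z l k).det := by
    intro k
    rw [← Matrix.cramer_apply, Matrix.cramer_eq_adjugate_mulVec]
    rfl
  simp only [Matrix.trace, Matrix.diag_apply, hc, Matrix.det_apply']
  rw [wirtinger_sum _ fun s _ => (hp s).differentiableAt.const_mul _, Finset.sum_comm]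
  refine Finset.sum_congr rfl fun s _ => ?_
  rw [wirtinger_const_mul _ (hp s).differentiableAt, hw, Finset.mul_sum]
  refine Finset.sum_congr rfl fun k _ => ?_
  rw [← Finset.mul_prod_erase _ _ (Finset.mem_univ k)]
  congr 2
  · simp
  · refine Finset.prod_congr rfl fun j hj => ?_
    simp [Finset.ne_of_mem_erase hj]

end Wirtinger

/-! ### Sesquilinear forms and Hermitian metrics -/

section Sesquilinear

variable {n : ℕ}

/-- The real bilinear form `2 Re (S_{i j̄} Xⁱ conj (Yʲ))` on `ℂⁿ`. -/
def sesqRe (S : Matrix (Fin n) (Fin n) ℂ) (X Y : Cn n) : ℝ :=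
  2 * (∑ i, ∑ j, X i * S i j * star (Y j)).re

theorem sesqRe_ex_ex (S : Matrix (Fin n) (Fin n) ℂ) (i j : Fin n) :
    sesqRe S (ex i) (ex j) = 2 * (S i j).re := by
  simp [sesqRe, ex, PiLp.single_apply]

theorem sesqRe_ey_ex (S : Matrix (Fin n) (Fin n) ℂ) (i j : Fin n) :
    sesqRe S (ey i) (ex j) = -2 * (S i j).im := by
  simp [sesqRe, ex, ey, PiLp.single_apply]

theorem sesqRe_swap (S : Matrix (Fin n) (Fin n) ℂ) (X Y : Cn n) :
    sesqRe S Y X = sesqRe Sᴴ X Y := by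
  unfold sesqRe
  rw [← Complex.conj_re, map_sum, Finset.sum_comm]
  congr 2
  simp only [map_sum]
  refine Finset.sum_congr rfl fun i _ => Finset.sum_congr rfl fun j _ => ?_
  simp only [Matrix.conjTranspose_apply, map_mul, Complex.star_def, Complex.conj_conj]
  ring

/-- The pairs `(ex i, ex j)` and `(ey i, ex j)` read off the real and imaginary parts of each entry.
-/
theorem sesqRe_inj {S T : Matrix (Fin n) (Fin n) ℂ} :
    (∀ X Y, sesqRe S X Y = sesqRe T X Y) ↔ S = T := by
  refine ⟨fun h => ?_, fun h => by simp [h]⟩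
  ext i j
  have h1 := h (ex i) (ex j)
  have h2 := h (ey i) (ex j)
  rw [sesqRe_ex_ex, sesqRe_ex_ex] at h1
  rw [sesqRe_ey_ex, sesqRe_ey_ex] at h2
  exact Complex.ext (by linarith) (by linarith)

theorem sesqRe_symm_iff {S : Matrix (Fin n) (Fin n) ℂ} :
    (∀ X Y, sesqRe S X Y = sesqRe S Y X) ↔ S.IsHermitian := by
  have h : (∀ X Y, sesqRe S X Y = sesqRe S Y X) ↔ ∀ X Y, sesqRe S X Y = sesqRe Sᴴ X Y :=
    forall₂_congr fun X Y => by rw [sesqRe_swap S X Y]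
  rw [h, sesqRe_inj, Matrix.IsHermitian, eq_comm]

theorem sesqRe_smul (r : ℝ) (S : Matrix (Fin n) (Fin n) ℂ) (X Y : Cn n) :
    sesqRe ((r : ℂ) • S) X Y = r * sesqRe S X Y := by
  have : ∑ i, ∑ j, X i * ((r : ℂ) • S) i j * star (Y j)
      = (r : ℂ) * ∑ i, ∑ j, X i * S i j * star (Y j) := by
    simp only [Finset.mul_sum, Matrix.smul_apply, smul_eq_mul]
    exact Finset.sum_congr rfl fun i _ => Finset.sum_congr rfl fun j _ => by ring
  rw [sesqRe, this, Complex.re_ofReal_mul, sesqRe]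
  ring

/-- `sesqRe` conjugates its second argument, whereas `Matrix.PosDef` conjugates the left vector;
passing to `star x` reconciles the two conventions. -/
theorem sesqRe_self_eq (S : Matrix (Fin n) (Fin n) ℂ) (x : Fin n → ℂ) :
    sesqRe S (WithLp.toLp 2 (star x)) (WithLp.toLp 2 (star x))
      = 2 * (star x ⬝ᵥ (S *ᵥ x)).re := by
  simp only [sesqRe, dotProduct, Matrix.mulVec, Pi.star_apply, star_star, Finset.mul_sum, mul_assoc]

theorem posDef_iff_sesqRe {S : Matrix (Fin n) (Fin n) ℂ} :
    S.PosDef ↔ S.IsHermitian ∧ ∀ X, X ≠ 0 → 0 < sesqRe S X X := by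
  constructor
  · refine fun h => ⟨h.isHermitian, fun X hX => ?_⟩
    have hX' : star (X.ofLp) ≠ 0 := by
      rw [Ne, star_eq_zero]
      exact fun h0 => hX (by ext i; exact congrFun h0 i)
    have h1 := sesqRe_self_eq S (star X.ofLp)
    rw [star_star] at h1
    have h2 := h.dotProduct_mulVec_pos hX'
    rw [star_star] at h2
    change sesqRe S X X = _ at h1
    rw [h1]
    have := (Complex.pos_iff.1 h2).1
    linarith
  · rintro ⟨h1, h2⟩
    refine Matrix.PosDef.of_dotProduct_mulVec_pos h1 fun x hx => ?_
    have h3 := h2 (WithLp.toLp 2 (star x)) fun h0 => hx (by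
      have := congrArg WithLp.ofLp h0
      simpa using this)
    rw [sesqRe_self_eq] at h3
    -- Positivity in the order on `ℂ` also requires the imaginary part to vanish, which is where
    -- Hermitian symmetry enters.
    have h4 : star (star x ⬝ᵥ (S *ᵥ x)) = star x ⬝ᵥ (S *ᵥ x) := by
      rw [← Matrix.star_dotProduct, Matrix.star_mulVec, h1.eq, Matrix.dotProduct_mulVec]
    exact Complex.pos_iff.2 ⟨by linarith, (Complex.conj_eq_iff_im.1 h4).symm⟩

/-- `G` is a smooth Riemannian metric on the open set `U ⊆ ℂⁿ` which is compatible with the complex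
structure. -/
structure IsHermitianOn (U : Set (Cn n)) (G : Cn n → Cn n → Cn n → ℝ) : Prop where
  isOpen : IsOpen U
  add_left : ∀ z ∈ U, ∀ u v w, G z (u + v) w = G z u w + G z v w
  smul_left : ∀ z ∈ U, ∀ (a : ℝ) (v w), G z (a • v) w = a * G z v w
  symm : ∀ z ∈ U, ∀ v w, G z v w = G z w v
  rot : ∀ z ∈ U, ∀ v w, G z (Complex.I • v) (Complex.I • w) = G z v w
  pos : ∀ z ∈ U, ∀ v, v ≠ 0 → 0 < G z v v
  smooth : ∀ v w, ContDiffOn ℝ ∞ (fun z => G z v w) U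

namespace IsHermitianOn

variable {U : Set (Cn n)} {G : Cn n → Cn n → Cn n → ℝ} (hG : IsHermitianOn U G)
include hG

theorem add_right {z : Cn n} (hz : z ∈ U) (u v w : Cn n) :
    G z u (v + w) = G z u v + G z u w := by
  rw [hG.symm z hz, hG.add_left z hz, hG.symm z hz v, hG.symm z hz w]

theorem smul_right {z : Cn n} (hz : z ∈ U) (a : ℝ) (v w : Cn n) :
    G z v (a • w) = a * G z v w := by
  rw [hG.symm z hz, hG.smul_left z hz, hG.symm z hz w]

/-- Invariance under $J$ leaves only the products `(ex, ex)` and `(ex, ey)`, and makes them twice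
the real and imaginary parts of $h_{i\bar j}$. This accounts for the factor 2 in `sesqRe`. -/
theorem eq_sesqRe {z : Cn n} (hz : z ∈ U) (v w : Cn n) :
    G z v w = sesqRe (hMatrix G z) v w := by
  let B : Cn n →ₗ[ℝ] Cn n →ₗ[ℝ] ℝ := LinearMap.mk₂ ℝ (G z) (hG.add_left z hz)
    (hG.smul_left z hz) (fun u v w => hG.add_right hz u v w) (fun a v w => hG.smul_right hz a v w)
  have hI : ∀ i : Fin n, Complex.I • (ex i : Cn n) = ey i := fun i => by
    ext j; simp [ex, ey, PiLp.single_apply]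
  have hI' : ∀ i : Fin n, Complex.I • (ey i : Cn n) = (-1 : ℝ) • ex i := fun i => by
    ext j; by_cases h : j = i <;> simp [ex, ey, h]
  have hyy : ∀ i j : Fin n, G z (ey i) (ey j) = G z (ex i) (ex j) := fun i j => by
    rw [← hI, ← hI, hG.rot z hz]
  have hyx : ∀ i j : Fin n, G z (ey i) (ex j) = - G z (ex i) (ey j) := fun i j => by
    rw [← hG.rot z hz (ey i), hI, hI', hG.smul_left z hz]; ring
  change B v w = _
  conv_lhs => rw [eq_sum_ex_ey v, eq_sum_ex_ey w]
  rw [map_sum B, LinearMap.sum_apply, sesqRe, Complex.re_sum, Finset.mul_sum]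
  refine Finset.sum_congr rfl fun i _ => ?_
  rw [map_sum, Complex.re_sum, Finset.mul_sum]
  refine Finset.sum_congr rfl fun j _ => ?_
  have hB : ∀ a b, B a b = G z a b := fun _ _ => rfl
  simp only [map_add, map_smul, LinearMap.add_apply, LinearMap.smul_apply, smul_eq_mul, hB, hyy,
    hyx, hMatrix, Matrix.of_apply]
  have e : ((G z (ex i) (ex j) : ℂ) + Complex.I * G z (ex i) (ey j)
      - Complex.I * ((-G z (ex i) (ey j) : ℝ) : ℂ) + G z (ex i) (ex j)) / 4
      = ⟨G z (ex i) (ex j) / 2, G z (ex i) (ey j) / 2⟩ := by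
    apply Complex.ext <;> simp <;> ring
  rw [e]
  simp only [Complex.mul_re, Complex.mul_im, Complex.star_def, Complex.conj_re, Complex.conj_im]
  ring

theorem posDef {z : Cn n} (hz : z ∈ U) : (hMatrix G z).PosDef := by
  refine posDef_iff_sesqRe.2 ⟨sesqRe_symm_iff.1 fun X Y => ?_, fun X hX => ?_⟩
  · rw [← hG.eq_sesqRe hz, ← hG.eq_sesqRe hz, hG.symm z hz]
  · rw [← hG.eq_sesqRe hz]
    exact hG.pos z hz X hX

theorem isUnit_det (z : Cn n) (hz : z ∈ U) : IsUnit (hMatrix G z).det :=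
  (hG.posDef hz).det_pos.ne'.isUnit

theorem smoothEntries : SmoothEntries U (hMatrix G) := fun k l => by
  have h : ∀ v w, ContDiffOn ℝ ∞ (fun z => (G z v w : ℂ)) U := fun v w =>
    Complex.ofRealCLM.contDiff.comp_contDiffOn (hG.smooth v w)
  simp only [hMatrix, Matrix.of_apply]
  have h1 := h (ex k) (ex l)
  have h2 := h (ex k) (ey l)
  have h3 := h (ey k) (ex l)
  have h4 := h (ey k) (ey l)
  fun_prop

theorem smoothEntries_inv : SmoothEntries U (fun z => (hMatrix G z)⁻¹) :=
  hG.smoothEntries.inv hG.isUnit_det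

/-- The sums over an orthonormal basis of `e^i conj(e^j)` and of `e^i e^j`. -/
theorem sum_orthonormal {z : Cn n} (hz : z ∈ U) {ι : Type*} [Fintype ι] [DecidableEq ι]
    (b : Module.Basis ι ℝ (Cn n)) (hb : ∀ a c, G z (b a) (b c) = if a = c then 1 else 0)
    (i j : Fin n) :
    ∑ a, (b a) i * star ((b a) j) = hInv G z i j ∧ ∑ a, (b a) i * (b a) j = 0 := by
  have hrepr : ∀ v : Cn n, v = ∑ a, G z v (b a) • b a := by
    intro v
    let B : Cn n →ₗ[ℝ] Cn n →ₗ[ℝ] ℝ := LinearMap.mk₂ ℝ (G z) (hG.add_left z hz)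
      (hG.smul_left z hz) (fun u v w => hG.add_right hz u v w)
      (fun a v w => hG.smul_right hz a v w)
    have : ∀ a, G z v (b a) = b.repr v a := by
      intro a
      change B v (b a) = _
      conv_lhs => rw [← b.sum_repr v]
      rw [map_sum, LinearMap.sum_apply, Finset.sum_eq_single a]
      · rw [map_smul, LinearMap.smul_apply]
        change _ • G z (b a) (b a) = _
        simp [hb]
      · intro c _ hca
        rw [map_smul, LinearMap.smul_apply]
        change _ • G z (b c) (b a) = _
        simp [hb, hca]
      · simp
    simp only [this]
    exact (b.sum_repr v).symm
  let P : Matrix (Fin n) (Fin n) ℂ := Matrix.of fun q i => ∑ a, (b a) i * star ((b a) q)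
  let Q : Matrix (Fin n) (Fin n) ℂ := Matrix.of fun q i => ∑ a, (b a) i * (b a) q
  have hH := (hG.posDef hz).isHermitian
  -- The expansion $v = \sum_a g(v,e_a)e_a$, split into its parts complex linear and antilinear in
  -- $v$. Testing on `ex p` and `ey p` separates them: the linear part is the identity, so $hP = 1$,
  -- and the antilinear part vanishes, so $h^TQ = 0$.
  have hexp : ∀ (v : Cn n) (i : Fin n), v i = ∑ p, v p * (hMatrix G z * P) p i
      + ∑ p, star (v p) * ((hMatrix G z)ᵀ * Q) p i := by
    intro v i
    have h1 := congrArg (fun w : Cn n => w i) (hrepr v)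
    simp only [WithLp.ofLp_sum, WithLp.ofLp_smul, Finset.sum_apply, Pi.smul_apply,
      Complex.real_smul] at h1
    rw [h1]
    have h2 : ∀ a, ((G z v (b a) : ℝ) : ℂ) = ∑ p, ∑ q, v p * hMatrix G z p q * star ((b a) q)
        + ∑ p, ∑ q, star (v p) * hMatrix G z q p * (b a) q := by
      intro a
      rw [hG.eq_sesqRe hz, sesqRe]
      rw [← Complex.add_conj, map_sum]
      congr 1
      refine Finset.sum_congr rfl fun p _ => ?_
      rw [map_sum]
      refine Finset.sum_congr rfl fun q _ => ?_
      simp only [map_mul, Complex.star_def, Complex.conj_conj]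
      rw [← Complex.star_def, hH.apply]
    simp only [h2, add_mul, Finset.sum_add_distrib, Finset.sum_mul]
    congr 1
    · rw [Finset.sum_comm]
      refine Finset.sum_congr rfl fun p _ => ?_
      simp only [Matrix.mul_apply, P, Matrix.of_apply, Finset.mul_sum]
      rw [Finset.sum_comm]
      refine Finset.sum_congr rfl fun q _ => Finset.sum_congr rfl fun a _ => by ring
    · rw [Finset.sum_comm]
      refine Finset.sum_congr rfl fun p _ => ?_
      simp only [Matrix.mul_apply, Q, Matrix.of_apply, Finset.mul_sum, Matrix.transpose_apply]
      rw [Finset.sum_comm]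
      refine Finset.sum_congr rfl fun q _ => Finset.sum_congr rfl fun a _ => by ring
  have hx : ∀ p i : Fin n, (ex p : Cn n) i = (hMatrix G z * P) p i
      + ((hMatrix G z)ᵀ * Q) p i := by
    intro p i
    rw [hexp (ex p) i]
    congr 1 <;>
      (rw [Finset.sum_eq_single p] <;> simp +contextual [ex])
  have hy : ∀ p i : Fin n, (ey p : Cn n) i = Complex.I * (hMatrix G z * P) p i
      - Complex.I * ((hMatrix G z)ᵀ * Q) p i := by
    intro p i
    rw [hexp (ey p) i, sub_eq_add_neg]
    congr 1 <;>
      (rw [Finset.sum_eq_single p] <;> simp +contextual [ey])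
  have hyx : ∀ p i : Fin n, (ey p : Cn n) i = Complex.I * (ex p : Cn n) i := fun p i => by
    simp [ex, ey, PiLp.single_apply]
  have hQ0 : (hMatrix G z)ᵀ * Q = 0 := by
    ext p i
    have h1 := hy p i
    rw [hyx, hx p i] at h1
    have h2 : (2 * Complex.I) * ((hMatrix G z)ᵀ * Q) p i = 0 := by linear_combination h1
    simpa using h2
  have hP1 : hMatrix G z * P = 1 := by
    ext p i
    have h1 := hx p i
    rw [hQ0] at h1
    simp only [Matrix.zero_apply, add_zero] at h1
    rw [← h1]
    simp [ex, PiLp.single_apply, Matrix.one_apply, eq_comm]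
  have hQ : Q = 0 := by
    have hu : IsUnit (hMatrix G z)ᵀ.det := by
      rw [Matrix.det_transpose]; exact hG.isUnit_det z hz
    have := congrArg (fun N => ((hMatrix G z)ᵀ)⁻¹ * N) hQ0
    simpa only [← Matrix.mul_assoc, Matrix.nonsing_inv_mul _ hu, Matrix.one_mul,
      Matrix.mul_zero] using this
  have hP : P = (hMatrix G z)⁻¹ := (Matrix.inv_eq_right_inv hP1).symm
  constructor
  · rw [hInv, ← hP]; rfl
  · exact congrFun (congrFun hQ j) i

end IsHermitianOn

end Sesquilinear

/-! ### The curvature of the Chern connection -/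

section Curvature

variable {n : ℕ}

/-- The connection matrix `(Γ_i)_{j k} = Γ_{ij}^k` of the Chern connection. -/
def gammaMatrix (G : Cn n → Cn n → Cn n → ℝ) (i : Fin n) (z : Cn n) : Matrix (Fin n) (Fin n) ℂ :=
  Matrix.of fun j k => chernGamma G z i j k

/-- The curvature matrix `(Θ_{i j̄})_{k l} = Θ_{i j̄ k l̄}` of the Chern connection. -/
def thetaMatrix (G : Cn n → Cn n → Cn n → ℝ) (i j : Fin n) (z : Cn n) :
    Matrix (Fin n) (Fin n) ℂ :=
  Matrix.of fun k l => chernTheta G z i j k l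

theorem gammaMatrix_eq (G : Cn n → Cn n → Cn n → ℝ) (i : Fin n) (z : Cn n) :
    gammaMatrix G i z = mwirtinger (-Complex.I) i (hMatrix G) z * (hMatrix G z)⁻¹ := by
  ext j k
  simp only [gammaMatrix, chernGamma, hInv, mwirtinger, Matrix.mul_apply, Matrix.of_apply,
    dz_eq_wirtinger]
  exact Finset.sum_congr rfl fun l _ => mul_comm _ _

theorem thetaMatrix_eq (G : Cn n → Cn n → Cn n → ℝ) (i j : Fin n) (z : Cn n) :
    thetaMatrix G i j z
      = -mwirtinger (-Complex.I) i (mwirtinger Complex.I j (hMatrix G)) z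
        + mwirtinger (-Complex.I) i (hMatrix G) z * (hMatrix G z)⁻¹
          * mwirtinger Complex.I j (hMatrix G) z := by
  ext k l
  simp only [thetaMatrix, chernTheta, hInv, mwirtinger, Matrix.mul_apply, Matrix.of_apply,
    dz_eq_wirtinger, dzbar_eq_wirtinger, Matrix.add_apply, Matrix.neg_apply]
  congr 1
  refine Finset.sum_congr rfl fun p _ => ?_
  rw [Finset.sum_mul]
  exact Finset.sum_congr rfl fun q _ => by ring

theorem realChern_const (G : Cn n → Cn n → Cn n → ℝ) (u w z : Cn n) (q : Fin n) :
    realChern G (fun _ => u) (fun _ => w) z q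
      = ∑ i, ∑ k, gammaMatrix G i z k q * u i * w k := by
  simp [realChern, gammaMatrix]

theorem sum_rotate {ι κ τ R : Type*} [Fintype ι] [Fintype κ] [Fintype τ] [AddCommMonoid R]
    (F : ι → κ → τ → R) : (∑ a, ∑ b, ∑ c, F a b c) = ∑ c, ∑ a, ∑ b, F a b c :=
  (Finset.sum_congr rfl fun _ _ => Finset.sum_comm).trans Finset.sum_comm

/-- The matrix `S_{i l̄} = h^{k j̄} Θ_{i j̄ k l̄}`. -/
def ricciMatrix (G : Cn n → Cn n → Cn n → ℝ) (z : Cn n) : Matrix (Fin n) (Fin n) ℂ :=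
  Matrix.of fun i l => ∑ k, ∑ j, hInv G z k j * chernTheta G z i j k l

namespace IsHermitianOn

variable {U : Set (Cn n)} {G : Cn n → Cn n → Cn n → ℝ} (hG : IsHermitianOn U G)
include hG

theorem smoothEntries_gammaMatrix (i : Fin n) : SmoothEntries U (gammaMatrix G i) := by
  have h := (hG.smoothEntries.mwirtinger hG.isOpen (-Complex.I) i).mul hG.smoothEntries_inv
  exact fun k l => (h k l).congr fun z _ => by rw [gammaMatrix_eq]

theorem mwirtinger_gammaMatrix {z : Cn n} (hz : z ∈ U) (c : ℂ) (i j : Fin n) :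
    mwirtinger c j (gammaMatrix G i) z
      = mwirtinger c j (mwirtinger (-Complex.I) i (hMatrix G)) z * (hMatrix G z)⁻¹
        - gammaMatrix G i z * (mwirtinger c j (hMatrix G) z * (hMatrix G z)⁻¹) := by
  have e : gammaMatrix G i
      = fun y => mwirtinger (-Complex.I) i (hMatrix G) y * (hMatrix G y)⁻¹ := by
    funext y; exact gammaMatrix_eq G i y
  rw [gammaMatrix_eq, e, mwirtinger_mul hG.isOpen hz (hG.smoothEntries.mwirtinger hG.isOpen _ _)
    hG.smoothEntries_inv, mwirtinger_inv hG.isOpen hz hG.smoothEntries hG.isUnit_det]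
  simp only [Matrix.mul_neg, ← Matrix.mul_assoc, sub_eq_add_neg]

/-- The first term is symmetric in $i, j$, and the product is what the connection term of a second
covariant derivative cancels. Together these leave no $(2,0)$ curvature. -/
theorem dz_gammaMatrix {z : Cn n} (hz : z ∈ U) (i j : Fin n) :
    mwirtinger (-Complex.I) j (gammaMatrix G i) z
      = mwirtinger (-Complex.I) j (mwirtinger (-Complex.I) i (hMatrix G)) z * (hMatrix G z)⁻¹
        - gammaMatrix G i z * gammaMatrix G j z := by
  rw [hG.mwirtinger_gammaMatrix hz, ← gammaMatrix_eq]

/-- The Chern curvature is $\bar\partial$ of the connection matrix, up to sign and lowering an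
index; the derivatives of $h$ are commuted to match $\Theta$. -/
theorem dzbar_gammaMatrix {z : Cn n} (hz : z ∈ U) (i j : Fin n) :
    mwirtinger Complex.I j (gammaMatrix G i) z = -(thetaMatrix G i j z * (hMatrix G z)⁻¹) := by
  rw [hG.mwirtinger_gammaMatrix hz, thetaMatrix_eq, gammaMatrix_eq,
    mwirtinger_comm hG.isOpen hz hG.smoothEntries]
  simp only [Matrix.add_mul, Matrix.neg_mul, ← Matrix.mul_assoc]
  abel

theorem contDiffOn_realChern_const (u w : Cn n) (q : Fin n) :
    ContDiffOn ℝ ∞ (fun z => realChern G (fun _ => u) (fun _ => w) z q) U := by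
  simp only [realChern_const]
  exact ContDiffOn.sum fun i _ => ContDiffOn.sum fun k _ =>
    ((hG.smoothEntries_gammaMatrix i k q).mul contDiffOn_const).mul contDiffOn_const

theorem wirtinger_realChern_const {z : Cn n} (hz : z ∈ U) (c : ℂ) (p : Fin n) (v w : Cn n)
    (q : Fin n) :
    wirtinger c p (fun y => realChern G (fun _ => v) (fun _ => w) y q) z
      = ∑ i, ∑ k, mwirtinger c p (gammaMatrix G i) z k q * v i * w k := by
  have hd : ∀ i k, DifferentiableAt ℝ (fun y => gammaMatrix G i y k q) z := fun i k =>
    (hG.smoothEntries_gammaMatrix i).differentiableAt hG.isOpen hz k q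
  have hd' : ∀ i k, DifferentiableAt ℝ (fun y => gammaMatrix G i y k q * v i * w k) z :=
    fun i k => ((hd i k).mul_const _).mul_const _
  simp only [realChern_const]
  rw [wirtinger_sum _ fun i _ => DifferentiableAt.fun_sum fun k _ => hd' i k]
  refine Finset.sum_congr rfl fun i _ => ?_
  rw [wirtinger_sum _ fun k _ => hd' i k]
  refine Finset.sum_congr rfl fun k _ => ?_
  have e : (fun y => gammaMatrix G i y k q * v i * w k)
      = fun y => (v i * w k) * gammaMatrix G i y k q := by funext y; ring
  rw [e, wirtinger_const_mul _ (hd i k)]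
  simp only [mwirtinger, Matrix.of_apply]
  ring

/-- The term $-\Gamma_i\Gamma_p$ in $\partial_p\Gamma_i$ cancels the connection term of the outer
derivative. What survives is a part symmetric in `u`, `v` and a part containing $\Theta$. -/
theorem realChern_realChern_const {z : Cn n} (hz : z ∈ U) (u v w : Cn n) (q : Fin n) :
    realChern G (fun _ => u) (realChern G (fun _ => v) (fun _ => w)) z q
      = ∑ p, ∑ i, ∑ k, (u p * v i * w k *
            (mwirtinger (-Complex.I) p (mwirtinger (-Complex.I) i (hMatrix G)) z
              * (hMatrix G z)⁻¹) k q
          - star (u p) * v i * w k * (thetaMatrix G i p z * (hMatrix G z)⁻¹) k q) := by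
  have hdiff : ∀ q, DifferentiableAt ℝ
      (fun y => realChern G (fun _ => v) (fun _ => w) y q) z := fun q =>
    ((hG.contDiffOn_realChern_const v w q).contDiffAt
      (hG.isOpen.mem_nhds hz)).differentiableAt (by simp)
  have hF : DifferentiableAt ℝ (realChern G (fun _ => v) (fun _ => w)) z :=
    (differentiableAt_piLp 2).2 hdiff
  have hcomp : (fderiv ℝ (realChern G (fun _ => v) (fun _ => w)) z u) q
      = fderiv ℝ (fun y => realChern G (fun _ => v) (fun _ => w) y q) z u := by
    have := (((EuclideanSpace.proj q : Cn n →L[ℂ] ℂ).restrictScalars ℝ).hasFDerivAt.comp z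
      hF.hasFDerivAt).fderiv
    have h2 := congrArg (fun T : Cn n →L[ℝ] ℂ => T u) this
    exact h2.symm
  have hsec : (∑ p, ∑ j, gammaMatrix G p z j q * u p
        * realChern G (fun _ => v) (fun _ => w) z j)
      = ∑ p, ∑ i, ∑ k, u p * v i * w k * (gammaMatrix G i z * gammaMatrix G p z) k q := by
    refine Finset.sum_congr rfl fun p _ => ?_
    simp only [realChern_const, Matrix.mul_apply, Finset.mul_sum]
    rw [Finset.sum_comm]
    refine Finset.sum_congr rfl fun i _ => ?_
    rw [Finset.sum_comm]
    exact Finset.sum_congr rfl fun k _ => Finset.sum_congr rfl fun j _ => by ring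
  have hmain : realChern G (fun _ => u) (realChern G (fun _ => v) (fun _ => w)) z q
      = fderiv ℝ (fun y => realChern G (fun _ => v) (fun _ => w) y q) z u
        + ∑ p, ∑ j, gammaMatrix G p z j q * u p
          * realChern G (fun _ => v) (fun _ => w) z j := by
    rw [← hcomp]; rfl
  rw [hmain, hsec, fderiv_apply_eq_sum, ← Finset.sum_add_distrib]
  refine Finset.sum_congr rfl fun p _ => ?_
  rw [dz_eq_wirtinger, dzbar_eq_wirtinger, hG.wirtinger_realChern_const hz,
    hG.wirtinger_realChern_const hz]
  simp only [Finset.mul_sum, ← Finset.sum_add_distrib]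
  refine Finset.sum_congr rfl fun i _ => Finset.sum_congr rfl fun k _ => ?_
  rw [hG.dz_gammaMatrix hz, hG.dzbar_gammaMatrix hz, Matrix.sub_apply, Matrix.neg_apply]
  ring

/-- Constant fields have zero bracket, and the symmetric second-derivative terms drop out on
exchanging `u` and `v`. -/
theorem realChernCurvature_apply {z : Cn n} (hz : z ∈ U) (u v w : Cn n) (q : Fin n) :
    realChernCurvature G z u v w q
      = ∑ i, ∑ j, ∑ k, (u i * star (v j) - v i * star (u j)) * w k
          * (thetaMatrix G i j z * (hMatrix G z)⁻¹) k q := by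
  have hb : realChern G (VectorField.lieBracket ℝ (fun _ => u) (fun _ => v)) (fun _ => w) z q
      = 0 := by
    have : VectorField.lieBracket ℝ (fun _ : Cn n => u) (fun _ => v) = fun _ => 0 := by
      funext y; simp [VectorField.lieBracket]
    rw [this, realChern_const]
    simp
  have h : realChernCurvature G z u v w q
      = realChern G (fun _ => u) (realChern G (fun _ => v) (fun _ => w)) z q
        - realChern G (fun _ => v) (realChern G (fun _ => u) (fun _ => w)) z q
        - realChern G (VectorField.lieBracket ℝ (fun _ => u) (fun _ => v)) (fun _ => w) z q :=
    rfl
  rw [h, hb, sub_zero, hG.realChern_realChern_const hz, hG.realChern_realChern_const hz]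
  simp only [Finset.sum_sub_distrib, sub_mul]
  have e1 : ∀ u v : Cn n, (∑ p, ∑ i, ∑ k, u p * v i * w k *
      (mwirtinger (-Complex.I) p (mwirtinger (-Complex.I) i (hMatrix G)) z
        * (hMatrix G z)⁻¹) k q) = ∑ p, ∑ i, ∑ k, v p * u i * w k *
      (mwirtinger (-Complex.I) p (mwirtinger (-Complex.I) i (hMatrix G)) z
        * (hMatrix G z)⁻¹) k q := by
    intro u v
    rw [Finset.sum_comm]
    refine Finset.sum_congr rfl fun i _ => Finset.sum_congr rfl fun p _ =>
      Finset.sum_congr rfl fun k _ => ?_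
    rw [mwirtinger_comm hG.isOpen hz hG.smoothEntries, mul_comm (u p)]
  have e2 : ∀ u v : Cn n, (∑ p, ∑ i, ∑ k, star (u p) * v i * w k *
      (thetaMatrix G i p z * (hMatrix G z)⁻¹) k q) = ∑ i, ∑ p, ∑ k, v i * star (u p) * w k *
      (thetaMatrix G i p z * (hMatrix G z)⁻¹) k q := by
    intro u v
    rw [Finset.sum_comm]
    refine Finset.sum_congr rfl fun i _ => Finset.sum_congr rfl fun p _ =>
      Finset.sum_congr rfl fun k _ => ?_
    rw [mul_comm (v i)]
  rw [e1 u v, e2, e2]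
  ring

theorem metric_realChernCurvature {z : Cn n} (hz : z ∈ U) (u v w y : Cn n) :
    G z (realChernCurvature G z u v w) y
      = 2 * (∑ i, ∑ j, ∑ k, ∑ l, (u i * star (v j) - v i * star (u j)) * w k
          * chernTheta G z i j k l * star (y l)).re := by
  rw [hG.eq_sesqRe hz, sesqRe]
  congr 2
  have h1 : ∀ i j k l, chernTheta G z i j k l
      = ∑ q, (thetaMatrix G i j z * (hMatrix G z)⁻¹) k q * hMatrix G z q l := by
    intro i j k l
    rw [← Matrix.mul_apply, Matrix.mul_assoc, Matrix.nonsing_inv_mul _ (hG.isUnit_det z hz),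
      Matrix.mul_one]
    rfl
  simp only [hG.realChernCurvature_apply hz, h1, Finset.sum_mul, Finset.mul_sum]
  have h2 : ∀ F : Fin n → Fin n → Fin n → Fin n → Fin n → ℂ,
      (∑ q, ∑ l, ∑ i, ∑ j, ∑ k, F q l i j k) = ∑ i, ∑ j, ∑ k, ∑ l, ∑ q, F q l i j k := by
    intro F
    rw [sum_rotate]
    refine Finset.sum_congr rfl fun i _ => ?_
    rw [sum_rotate]
    refine Finset.sum_congr rfl fun j _ => ?_
    rw [sum_rotate]
    exact Finset.sum_congr rfl fun k _ => Finset.sum_comm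
  rw [h2]
  refine Finset.sum_congr rfl fun i _ => Finset.sum_congr rfl fun j _ =>
    Finset.sum_congr rfl fun k _ => Finset.sum_congr rfl fun l _ =>
    Finset.sum_congr rfl fun q _ => by ring

/-- In the trace, $X^i\overline{e_a^j}e_a^k$ sums to $X^ih^{k\bar j}$, while the other term contains
$e_a^ie_a^k$, both unconjugated, and sums to zero. -/
theorem sum_metric_realChernCurvature {z : Cn n} (hz : z ∈ U) {ι : Type*} [Fintype ι]
    [DecidableEq ι] (b : Module.Basis ι ℝ (Cn n))
    (hb : ∀ a c, G z (b a) (b c) = if a = c then 1 else 0) (X Y : Cn n) :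
    ∑ a, G z (realChernCurvature G z X (b a) (b a)) Y = sesqRe (ricciMatrix G z) X Y := by
  simp only [hG.metric_realChernCurvature hz]
  rw [← Finset.mul_sum, ← Complex.re_sum, sesqRe]
  congr 2
  rw [Finset.sum_comm]
  refine Finset.sum_congr rfl fun i _ => ?_
  have h1 : ∀ j k l : Fin n, ∑ a, (X i * star ((b a) j) - (b a) i * star (X j)) * (b a) k
        * chernTheta G z i j k l * star (Y l)
      = X i * (hInv G z k j * chernTheta G z i j k l) * star (Y l) := by
    intro j k l
    have e1 := (hG.sum_orthonormal hz b hb k j).1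
    have e2 := (hG.sum_orthonormal hz b hb i k).2
    rw [← Finset.sum_mul, ← Finset.sum_mul]
    have : ∑ a, (X i * star ((b a) j) - (b a) i * star (X j)) * (b a) k
        = X i * (∑ a, (b a) k * star ((b a) j)) - star (X j) * ∑ a, (b a) i * (b a) k := by
      rw [Finset.mul_sum, Finset.mul_sum, ← Finset.sum_sub_distrib]
      exact Finset.sum_congr rfl fun a _ => by ring
    rw [this, e1, e2]
    ring
  have h2 : (∑ a, ∑ j, ∑ k, ∑ l, (X i * star ((b a) j) - (b a) i * star (X j)) * (b a) k
        * chernTheta G z i j k l * star (Y l))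
      = ∑ j, ∑ k, ∑ l, ∑ a, (X i * star ((b a) j) - (b a) i * star (X j)) * (b a) k
        * chernTheta G z i j k l * star (Y l) := by
    rw [Finset.sum_comm]
    refine Finset.sum_congr rfl fun j _ => ?_
    rw [Finset.sum_comm]
    refine Finset.sum_congr rfl fun k _ => ?_
    rw [Finset.sum_comm]
  rw [h2]
  simp only [h1, ricciMatrix, Matrix.of_apply, Finset.mul_sum, Finset.sum_mul]
  have h3 : ∀ F : Fin n → Fin n → Fin n → ℂ,
      (∑ j, ∑ k, ∑ l, F j k l) = ∑ l, ∑ k, ∑ j, F j k l := by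
    intro F
    rw [sum_rotate]
    exact Finset.sum_congr rfl fun l _ => Finset.sum_comm
  exact h3 _

end IsHermitianOn

end Curvature

/-! ### Integration by parts -/

section IntegrationByParts

variable {n : ℕ} {U : Set (Cn n)}

/-- Off `U` the factor `f` is uncontrolled, but `φ` vanishes near every such point. -/
theorem contDiff_mul_of_tsupport_subset (hU : IsOpen U) {f φ : Cn n → ℂ}
    (hf : ContDiffOn ℝ ∞ f U) (hφ : ContDiff ℝ ∞ φ) (hs : tsupport φ ⊆ U) :
    ContDiff ℝ ∞ (fun z => f z * φ z) := by
  rw [contDiff_iff_contDiffAt]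
  intro z
  by_cases hz : z ∈ U
  · exact (hf.contDiffAt (hU.mem_nhds hz)).mul hφ.contDiffAt
  · have h0 : φ =ᶠ[nhds z] 0 := notMem_tsupport_iff_eventuallyEq.1 fun h => hz (hs h)
    refine (contDiffAt_const (c := (0 : ℂ))).congr_of_eventuallyEq ?_
    filter_upwards [h0] with y hy
    simp [hy]

theorem eq_zero_of_notMem {φ : Cn n → ℂ} (hs : tsupport φ ⊆ U) {z : Cn n} (hz : z ∉ U) :
    φ z = 0 :=
  image_eq_zero_of_notMem_tsupport fun h => hz (hs h)

theorem integrable_mul_of_tsupport_subset (hU : IsOpen U) {f φ : Cn n → ℂ}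
    (hf : ContDiffOn ℝ ∞ f U) (hφ : ContDiff ℝ ∞ φ) (hc : HasCompactSupport φ)
    (hs : tsupport φ ⊆ U) : Integrable (fun z => f z * φ z) :=
  (contDiff_mul_of_tsupport_subset hU hf hφ hs).continuous.integrable_of_hasCompactSupport
    hc.mul_left

theorem support_wirtinger_subset (c : ℂ) (i : Fin n) (φ : Cn n → ℂ) :
    Function.support (wirtinger c i φ) ⊆ tsupport φ := by
  intro z hz
  by_contra h
  refine hz ?_
  rw [wirtinger_congr (notMem_tsupport_iff_eventuallyEq.1 h)]
  exact wirtinger_const c i 0 z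

theorem tsupport_wirtinger_subset (c : ℂ) (i : Fin n) (φ : Cn n → ℂ) :
    tsupport (wirtinger c i φ) ⊆ tsupport φ :=
  closure_minimal (support_wirtinger_subset c i φ) (isClosed_tsupport φ)

theorem contDiff_wirtinger {c : ℂ} {i : Fin n} {φ : Cn n → ℂ} (hφ : ContDiff ℝ ∞ φ) :
    ContDiff ℝ ∞ (wirtinger c i φ) :=
  contDiffOn_univ.1 (contDiffOn_wirtinger isOpen_univ hφ.contDiffOn)

theorem integral_fderiv_eq_zero {F : Cn n → ℂ} (hF : ContDiff ℝ ∞ F) (hc : HasCompactSupport F)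
    (v : Cn n) : Integrable (fun z => fderiv ℝ F z v) ∧ ∫ z, fderiv ℝ F z v = 0 := by
  have hd : Integrable (fun z => fderiv ℝ F z v) := by
    have h1 : Continuous (fun z => fderiv ℝ F z v) :=
      (hF.continuous_fderiv (by simp)).clm_apply continuous_const
    exact h1.integrable_of_hasCompactSupport (hc.fderiv_apply ℝ v)
  refine ⟨hd, ?_⟩
  -- Integration by parts against the constant function 1.
  have h := integral_mul_fderiv_eq_neg_fderiv_mul_of_integrable (μ := (volume : Measure (Cn n)))
    (f := fun _ => (1 : ℂ)) (g := F) (v := v) (by simp) (by simpa using hd)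
    (by simpa using hF.continuous.integrable_of_hasCompactSupport hc)
    (fun _ _ => differentiableAt_const _) (fun x _ => hF.differentiable (by simp) x)
  simpa using h

theorem integral_wirtinger_mul (hU : IsOpen U) {c : ℂ} {i : Fin n} {f φ : Cn n → ℂ}
    (hf : ContDiffOn ℝ ∞ f U) (hφ : ContDiff ℝ ∞ φ) (hc : HasCompactSupport φ)
    (hs : tsupport φ ⊆ U) :
    ∫ z, wirtinger c i f z * φ z = -∫ z, f z * wirtinger c i φ z := by
  have hF := contDiff_mul_of_tsupport_subset hU hf hφ hs
  have hcF : HasCompactSupport (fun z => f z * φ z) := hc.mul_left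
  have h0 : ∫ z, wirtinger c i (fun z => f z * φ z) z = 0 := by
    obtain ⟨i1, e1⟩ := integral_fderiv_eq_zero hF hcF (ex i)
    obtain ⟨i2, e2⟩ := integral_fderiv_eq_zero hF hcF (ey i)
    simp only [wirtinger]
    rw [integral_div, integral_add i1 (i2.const_mul c), integral_const_mul, e1, e2]
    simp
  -- The product rule holds at every point: outside `U`, where `f` need not be differentiable, all
  -- three terms are zero.
  have h1 : (fun z => wirtinger c i (fun z => f z * φ z) z)
      = fun z => wirtinger c i f z * φ z + f z * wirtinger c i φ z := by
    funext z
    by_cases hz : z ∈ U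
    · exact wirtinger_mul ((hf.contDiffAt (hU.mem_nhds hz)).differentiableAt (by simp))
        (hφ.differentiable (by simp) z)
    · have e1 : φ z = 0 := eq_zero_of_notMem hs hz
      have e2 : wirtinger c i φ z = 0 :=
        eq_zero_of_notMem ((tsupport_wirtinger_subset c i φ).trans hs) hz
      have e3 : (fun z => f z * φ z) =ᶠ[nhds z] fun _ => 0 := by
        filter_upwards [notMem_tsupport_iff_eventuallyEq.1 fun h => hz (hs h)] with y hy
        simp [hy]
      rw [e1, e2, wirtinger_congr e3, wirtinger_const]
      simp
  rw [h1, integral_add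
    (integrable_mul_of_tsupport_subset hU (contDiffOn_wirtinger hU hf) hφ hc hs)
    (integrable_mul_of_tsupport_subset hU hf (contDiff_wirtinger hφ)
      (hc.of_isClosed_subset (isClosed_tsupport _) (tsupport_wirtinger_subset c i φ))
      ((tsupport_wirtinger_subset c i φ).trans hs))] at h0
  exact eq_neg_of_add_eq_zero_left h0

end IntegrationByParts

/-! ### The formal adjoint of `∂` -/

section Adjoint

variable {n : ℕ}

/-- The torsion matrix `(T_j)_{k l} = ∂h_{k l̄}/∂z̄ʲ - ∂h_{k j̄}/∂z̄ˡ`. -/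
def torsionMatrix (G : Cn n → Cn n → Cn n → ℝ) (j : Fin n) (z : Cn n) :
    Matrix (Fin n) (Fin n) ℂ :=
  Matrix.of fun k l => dzbar j (fun y => hMatrix G y k l) z - dzbar l (fun y => hMatrix G y k j) z

/-- The explicit formula `∂^*ω = -√-1 h^{k l̄} (∂h_{k l̄}/∂z̄ʲ - ∂h_{k j̄}/∂z̄ˡ) dz̄ʲ`. -/
def delStarOmega (G : Cn n → Cn n → Cn n → ℝ) (z : Cn n) (j : Fin n) : ℂ :=
  -Complex.I * ((hMatrix G z)⁻¹ * torsionMatrix G j z).trace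

namespace IsHermitianOn

variable {U : Set (Cn n)} {G : Cn n → Cn n → Cn n → ℝ} (hG : IsHermitianOn U G)
include hG

theorem smoothEntries_torsionMatrix (j : Fin n) : SmoothEntries U (torsionMatrix G j) :=
  fun k l => (contDiffOn_wirtinger hG.isOpen (hG.smoothEntries k l)).sub
    (contDiffOn_wirtinger hG.isOpen (hG.smoothEntries k j))

theorem contDiffOn_delStarOmega : ContDiffOn ℝ ∞ (delStarOmega G) U := by
  refine contDiffOn_pi.2 fun j => ?_
  have h := hG.smoothEntries_inv.mul (hG.smoothEntries_torsionMatrix j)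
  exact contDiffOn_const.mul (ContDiffOn.sum fun k _ => h k k)

theorem mwirtinger_torsionMatrix {z : Cn n} (hz : z ∈ U) (c : ℂ) (i j k l : Fin n) :
    mwirtinger c i (torsionMatrix G j) z k l
      = mwirtinger c i (mwirtinger Complex.I j (hMatrix G)) z k l
        - mwirtinger c i (mwirtinger Complex.I l (hMatrix G)) z k j :=
  wirtinger_sub ((hG.smoothEntries.mwirtinger hG.isOpen Complex.I j).differentiableAt hG.isOpen
      hz k l) ((hG.smoothEntries.mwirtinger hG.isOpen Complex.I l).differentiableAt hG.isOpen
      hz k j)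

theorem wirtinger_delStarOmega {z : Cn n} (hz : z ∈ U) (c : ℂ) (i j : Fin n) :
    wirtinger c i (fun y => delStarOmega G y j) z
      = -Complex.I * ((hMatrix G z)⁻¹ * (mwirtinger c i (torsionMatrix G j) z
          - mwirtinger c i (hMatrix G) z * (hMatrix G z)⁻¹ * torsionMatrix G j z)).trace := by
  have h := hG.smoothEntries_inv.mul (hG.smoothEntries_torsionMatrix j)
  have hd := h.differentiableAt hG.isOpen hz
  have h1 := mwirtinger_mul (c := c) (i := i) hG.isOpen hz hG.smoothEntries_inv
    (hG.smoothEntries_torsionMatrix j)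
  rw [mwirtinger_inv hG.isOpen hz hG.smoothEntries hG.isUnit_det] at h1
  have h2 : (hMatrix G z)⁻¹ * (mwirtinger c i (torsionMatrix G j) z
          - mwirtinger c i (hMatrix G) z * (hMatrix G z)⁻¹ * torsionMatrix G j z)
      = mwirtinger c i (fun y => (hMatrix G y)⁻¹ * torsionMatrix G j y) z := by
    rw [h1, Matrix.mul_sub, Matrix.neg_mul]
    simp only [← Matrix.mul_assoc]
    abel
  rw [h2]
  have h3 : wirtinger c i (fun y => ∑ k, ((hMatrix G y)⁻¹ * torsionMatrix G j y) k k) z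
      = ∑ k, wirtinger c i (fun y => ((hMatrix G y)⁻¹ * torsionMatrix G j y) k k) z :=
    wirtinger_sum _ fun k _ => hd k k
  have h4 : wirtinger c i (fun y => delStarOmega G y j) z = -Complex.I *
      wirtinger c i (fun y => ∑ k, ((hMatrix G y)⁻¹ * torsionMatrix G j y) k k) z :=
    wirtinger_const_mul _ (DifferentiableAt.fun_sum fun k _ => hd k k)
  rw [h4, h3]
  rfl

/-- A Bianchi-type identity: differentiating the torsion trace, the derivative of $h^{-1}$ supplies
the quadratic terms that complete $\partial_i$ of the torsion to $-(\Theta_{i\bar jk\bar l} -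
\Theta_{i\bar lk\bar j})$. The unswapped trace is $\Theta^{(1)}$, so only the swapped one survives.
-/
theorem thetaOne_sub_del_delStarOmega {z : Cn n} (hz : z ∈ U) :
    thetaOne G z - del (delStarOmega G) z = Complex.I • ricciMatrix G z := by
  ext i j
  have h1 : (Matrix.of fun k l => chernTheta G z i j k l - chernTheta G z i l k j)
      = -(mwirtinger (-Complex.I) i (torsionMatrix G j) z
        - mwirtinger (-Complex.I) i (hMatrix G) z * (hMatrix G z)⁻¹ * torsionMatrix G j z) := by
    ext k l
    change thetaMatrix G i j z k l - thetaMatrix G i l z k j = _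
    rw [thetaMatrix_eq, thetaMatrix_eq]
    simp only [Matrix.add_apply, Matrix.neg_apply, Matrix.sub_apply,
      hG.mwirtinger_torsionMatrix hz]
    have : (mwirtinger (-Complex.I) i (hMatrix G) z * (hMatrix G z)⁻¹ * torsionMatrix G j z) k l
        = (mwirtinger (-Complex.I) i (hMatrix G) z * (hMatrix G z)⁻¹
            * mwirtinger Complex.I j (hMatrix G) z) k l
          - (mwirtinger (-Complex.I) i (hMatrix G) z * (hMatrix G z)⁻¹
            * mwirtinger Complex.I l (hMatrix G) z) k j := by
      rw [Matrix.mul_apply, Matrix.mul_apply (M := _ * _) (N := mwirtinger Complex.I j _ _),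
        Matrix.mul_apply (M := _ * _) (N := mwirtinger Complex.I l _ _), ← Finset.sum_sub_distrib]
      exact Finset.sum_congr rfl fun p _ => mul_sub _ _ _
    rw [this]
    ring
  have h2 : del (delStarOmega G) z i j
      = Complex.I * ∑ k, ∑ l, hInv G z k l * (chernTheta G z i j k l - chernTheta G z i l k j) := by
    have e : del (delStarOmega G) z i j
        = wirtinger (-Complex.I) i (fun y => delStarOmega G y j) z := by
      rw [← dz_eq_wirtinger]; rfl
    rw [e, hG.wirtinger_delStarOmega hz, ← neg_eq_iff_eq_neg.2 h1, Matrix.mul_neg, Matrix.trace_neg, neg_mul_neg, Matrix.trace]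
    simp only [Matrix.diag_apply, Matrix.mul_apply, Matrix.of_apply]
    rw [Finset.sum_comm]
    rfl
  rw [Matrix.sub_apply, h2]
  simp only [thetaOne, ricciMatrix, Matrix.of_apply, Matrix.smul_apply, smul_eq_mul]
  rw [← mul_sub, ← Finset.sum_sub_distrib]
  congr 1
  refine Finset.sum_congr rfl fun k _ => ?_
  rw [← Finset.sum_sub_distrib]
  exact Finset.sum_congr rfl fun l _ => by ring

/-- The divergence form of $\partial^*\omega$: the two halves of the torsion trace are the
derivative of $\det h$ (Jacobi) and that of $h^{-1}$. It is what makes integration by parts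
applicable. -/
theorem sum_dzbar_inv_mul_det {z : Cn n} (hz : z ∈ U) (l : Fin n) :
    ∑ j, hInv G z l j * delStarOmega G z j * (hMatrix G z).det
      = -Complex.I * ∑ j, wirtinger Complex.I j
          (fun y => hInv G y l j * (hMatrix G y).det) z := by
  have hu := hG.isUnit_det z hz
  have hadj : (hMatrix G z).adjugate = (hMatrix G z).det • (hMatrix G z)⁻¹ := by
    rw [Matrix.inv_def, smul_smul, Ring.mul_inverse_cancel _ hu, one_smul]
  have h1 : ∀ j, wirtinger Complex.I j (fun y => hInv G y l j * (hMatrix G y).det) z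
      = -((hMatrix G z)⁻¹ * mwirtinger Complex.I j (hMatrix G) z * (hMatrix G z)⁻¹) j l
          * (hMatrix G z).det
        + hInv G z l j * ((hMatrix G z).det
          * ((hMatrix G z)⁻¹ * mwirtinger Complex.I j (hMatrix G) z).trace) := by
    intro j
    have hd : DifferentiableAt ℝ (fun y => hInv G y l j) z :=
      hG.smoothEntries_inv.differentiableAt hG.isOpen hz j l
    rw [wirtinger_mul hd
      ((hG.smoothEntries.det.contDiffAt (hG.isOpen.mem_nhds hz)).differentiableAt (by simp)),
      wirtinger_det hG.isOpen hz hG.smoothEntries, hadj, Matrix.smul_mul, Matrix.trace_smul,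
      smul_eq_mul]
    have h2 := congrFun (congrFun (mwirtinger_inv (c := Complex.I) (i := j) hG.isOpen hz
      hG.smoothEntries hG.isUnit_det) j) l
    rw [Matrix.neg_apply] at h2
    rw [← h2]
    rfl
  have h3 : ∀ j, ((hMatrix G z)⁻¹ * torsionMatrix G j z).trace
      = ((hMatrix G z)⁻¹ * mwirtinger Complex.I j (hMatrix G) z).trace
        - ∑ m, ((hMatrix G z)⁻¹ * mwirtinger Complex.I m (hMatrix G) z) m j := by
    intro j
    rw [Matrix.trace, Matrix.trace, ← Finset.sum_sub_distrib]
    refine Finset.sum_congr rfl fun m _ => ?_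
    rw [Matrix.diag_apply, Matrix.diag_apply, Matrix.mul_apply, Matrix.mul_apply,
      Matrix.mul_apply, ← Finset.sum_sub_distrib]
    exact Finset.sum_congr rfl fun k _ => mul_sub _ _ _
  have h4 : ∑ j, hInv G z l j * ∑ m, ((hMatrix G z)⁻¹ * mwirtinger Complex.I m (hMatrix G) z) m j
      = ∑ m, ((hMatrix G z)⁻¹ * mwirtinger Complex.I m (hMatrix G) z * (hMatrix G z)⁻¹) m l := by
    simp only [Finset.mul_sum]
    rw [Finset.sum_comm]
    refine Finset.sum_congr rfl fun m _ => ?_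
    rw [Matrix.mul_apply (M := _ * _)]
    exact Finset.sum_congr rfl fun j _ => mul_comm _ _
  have h5 : ∀ (h a P Q : Fin n → ℂ) (c d : ℂ), ∑ j, h j * P j = ∑ j, Q j →
      ∑ j, h j * (c * (a j - P j)) * d = c * ∑ j, (-Q j * d + h j * (d * a j)) := by
    intro h a P Q c d hPQ
    have e1 : ∑ j, h j * (c * (a j - P j)) * d
        = c * d * (∑ j, h j * a j - ∑ j, h j * P j) := by
      rw [← Finset.sum_sub_distrib, Finset.mul_sum]
      exact Finset.sum_congr rfl fun j _ => by ring
    have e2 : ∑ j, (-Q j * d + h j * (d * a j)) = d * (∑ j, h j * a j - ∑ j, Q j) := by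
      rw [← Finset.sum_sub_distrib, Finset.mul_sum]
      exact Finset.sum_congr rfl fun j _ => by ring
    rw [e1, e2, hPQ, mul_assoc]
  simp only [h1, delStarOmega, h3]
  exact h5 _ _ _ _ _ _ h4

/-- Pairing with $\omega$ is a trace, because $h^{-1}hh^{-1} = h^{-1}$; conjugation turns
$\partial\eta$ into $\bar\partial$ of the conjugate. -/
theorem inner11_omegaForm_del {z : Cn n} (hz : z ∈ U) {η : Cn n → Fin n → ℂ}
    (hη : ∀ l, DifferentiableAt ℝ (fun y => η y l) z) :
    inner11 G z (omegaForm G z) (del η z)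
      = Complex.I * ∑ l, ∑ j, hInv G z l j * wirtinger Complex.I j (fun y => star (η y l)) z := by
  have h1 : ∀ k l, star (del η z k l) = wirtinger Complex.I k (fun y => star (η y l)) z :=
    fun k l => (dzbar_star k (hη l)).symm
  have h2 : ∀ k l, hInv G z l k
      = ∑ i, ∑ j, (hMatrix G z)⁻¹ k i * hMatrix G z i j * (hMatrix G z)⁻¹ j l := by
    intro k l
    have : (hMatrix G z)⁻¹ = (hMatrix G z)⁻¹ * hMatrix G z * (hMatrix G z)⁻¹ := by
      rw [Matrix.nonsing_inv_mul _ (hG.isUnit_det z hz), Matrix.one_mul]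
    rw [hInv]
    conv_lhs => rw [this, Matrix.mul_apply]
    simp only [Matrix.mul_apply, Finset.sum_mul]
    exact Finset.sum_comm
  have h3 : inner11 G z (omegaForm G z) (del η z) = ∑ i, ∑ j, ∑ k, ∑ l,
      (hMatrix G z)⁻¹ k i * (hMatrix G z)⁻¹ j l * (Complex.I • hMatrix G z) i j
        * wirtinger Complex.I k (fun y => star (η y l)) z := by
    simp only [inner11, h1]
    rfl
  rw [h3]
  simp only [h2, Finset.mul_sum, Finset.sum_mul]
  rw [sum_rotate]
  conv_rhs => rw [Finset.sum_comm]
  refine Finset.sum_congr rfl fun k _ => ?_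
  rw [sum_rotate]
  refine Finset.sum_congr rfl fun l _ => Finset.sum_congr rfl fun i _ =>
    Finset.sum_congr rfl fun j _ => ?_
  simp only [Matrix.smul_apply, smul_eq_mul]
  ring

/-- With $A = h^{l\bar j}\det h$ and $\varphi = \overline{\eta_{\bar l}}$, one side integrates
$-\sqrt{-1}\,\bar\partial_jA\cdot\varphi$ and the other $\sqrt{-1}\,A\,\bar\partial_j\varphi$, up to
the common factor $2^n$; these agree after one integration by parts. -/
theorem isDelStar_delStarOmega : IsDelStar U G (omegaForm G) (delStarOmega G) := by
  refine ⟨hG.contDiffOn_delStarOmega, fun η hη hc hs => ?_⟩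
  have hη' : ∀ l, ContDiff ℝ ∞ (fun y => η y l) := contDiff_pi.1 hη
  let φ : Fin n → Cn n → ℂ := fun l y => star (η y l)
  have hφ : ∀ l, ContDiff ℝ ∞ (φ l) := fun l =>
    (starL' ℝ (A := ℂ)).contDiff.comp (hη' l)
  have hsub : ∀ l, tsupport (φ l) ⊆ tsupport η := fun l =>
    closure_mono fun y hy => by
      intro h0
      apply hy
      simp [φ, h0]
  have hφs : ∀ l, tsupport (φ l) ⊆ U := fun l => (hsub l).trans hs
  have hφc : ∀ l, HasCompactSupport (φ l) := fun l =>
    hc.of_isClosed_subset (isClosed_tsupport _) (hsub l)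
  let A : Fin n → Fin n → Cn n → ℂ := fun l j y => hInv G y l j * (hMatrix G y).det
  have hA : ∀ l j, ContDiffOn ℝ ∞ (A l j) U := fun l j =>
    (hG.smoothEntries_inv j l).mul hG.smoothEntries.det
  have e1 : ∀ z ∈ U, inner01 G z (delStarOmega G z) (η z) * volDensity G z
      = ∑ l, ∑ j, (-Complex.I * 2 ^ n) * (wirtinger Complex.I j (A l j) z * φ l z) := by
    intro z hz
    have h := fun l => hG.sum_dzbar_inv_mul_det hz l
    have h' : inner01 G z (delStarOmega G z) (η z) * volDensity G z = ∑ l, 2 ^ n * φ l z *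
        ∑ j, hInv G z l j * delStarOmega G z j * (hMatrix G z).det := by
      simp only [inner01, volDensity, Finset.sum_mul, Finset.mul_sum]
      rw [Finset.sum_comm]
      exact Finset.sum_congr rfl fun l _ => Finset.sum_congr rfl fun j _ => by ring
    rw [h']
    refine Finset.sum_congr rfl fun l _ => ?_
    rw [h, Finset.mul_sum, Finset.mul_sum]
    exact Finset.sum_congr rfl fun j _ => by ring
  have e2 : ∀ z ∈ U, inner11 G z (omegaForm G z) (del η z) * volDensity G z
      = ∑ l, ∑ j, (Complex.I * 2 ^ n) * (A l j z * wirtinger Complex.I j (φ l) z) := by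
    intro z hz
    rw [hG.inner11_omegaForm_del hz fun l => (hη' l).differentiable (by simp) z]
    simp only [volDensity, Finset.sum_mul, Finset.mul_sum]
    exact Finset.sum_congr rfl fun l _ => Finset.sum_congr rfl fun j _ => by
      simp only [A, φ]; ring
  rw [setIntegral_congr_fun hG.isOpen.measurableSet e1,
    setIntegral_congr_fun hG.isOpen.measurableSet e2]
  have hws : ∀ l j, tsupport (wirtinger Complex.I j (φ l)) ⊆ U := fun l j =>
    (tsupport_wirtinger_subset _ _ _).trans (hφs l)
  have i1 : ∀ l j, Integrable (fun z => wirtinger Complex.I j (A l j) z * φ l z) := fun l j =>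
    integrable_mul_of_tsupport_subset hG.isOpen (contDiffOn_wirtinger hG.isOpen (hA l j)) (hφ l)
      (hφc l) (hφs l)
  have i2 : ∀ l j, Integrable (fun z => A l j z * wirtinger Complex.I j (φ l) z) := fun l j =>
    integrable_mul_of_tsupport_subset hG.isOpen (hA l j) (contDiff_wirtinger (hφ l))
      ((hφc l).of_isClosed_subset (isClosed_tsupport _) (tsupport_wirtinger_subset _ _ _))
      (hws l j)
  rw [integral_finsetSum _ fun l _ => integrable_finsetSum _ fun j _ =>
      ((i1 l j).const_mul _).restrict,
    integral_finsetSum _ fun l _ => integrable_finsetSum _ fun j _ =>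
      ((i2 l j).const_mul _).restrict]
  refine Finset.sum_congr rfl fun l _ => ?_
  rw [integral_finsetSum _ fun j _ => ((i1 l j).const_mul _).restrict,
    integral_finsetSum _ fun j _ => ((i2 l j).const_mul _).restrict]
  refine Finset.sum_congr rfl fun j _ => ?_
  rw [integral_const_mul, integral_const_mul,
    setIntegral_eq_integral_of_forall_compl_eq_zero fun z hz => by
      rw [eq_zero_of_notMem (hφs l) hz, mul_zero],
    setIntegral_eq_integral_of_forall_compl_eq_zero fun z hz => by
      rw [eq_zero_of_notMem (hws l j) hz, mul_zero],
    integral_wirtinger_mul hG.isOpen (hA l j) (hφ l) (hφc l) (hφs l)]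
  ring

/-- The fundamental lemma of the calculus of variations, followed by continuity to pass from almost
everywhere to everywhere, gives equality of $h^{l\bar j}\alpha_{\bar j}$ times the volume density.
Both factors are invertible. -/
theorem eqOn_of_isDelStar {β : Cn n → Matrix (Fin n) (Fin n) ℂ} {α α' : Cn n → Fin n → ℂ}
    (h : IsDelStar U G β α) (h' : IsDelStar U G β α') : Set.EqOn α α' U := by
  have hK := fun j l => hG.smoothEntries_inv j l
  have hvol : ContDiffOn ℝ ∞ (volDensity G) U := contDiffOn_const.mul hG.smoothEntries.det
  let f : (Cn n → Fin n → ℂ) → Fin n → Cn n → ℂ := fun α l z =>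
    (∑ j, hInv G z l j * α z j) * volDensity G z
  have hf : ∀ α : Cn n → Fin n → ℂ, ContDiffOn ℝ ∞ α U → ∀ l, ContDiffOn ℝ ∞ (f α l) U :=
    fun α hα l => (ContDiffOn.sum fun j _ => (hK j l).mul (contDiffOn_pi.1 hα j)).mul hvol
  have hfl : ∀ l, Set.EqOn (fun z => f α l z - f α' l z) (fun _ => 0) U := by
    intro l
    have hc : ContDiffOn ℝ ∞ (fun z => f α l z - f α' l z) U := (hf α h.1 l).sub (hf α' h'.1 l)
    refine Measure.eqOn_open_of_ae_eq (μ := (volume : Measure (Cn n))) ?_ hG.isOpen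
      hc.continuousOn continuousOn_const
    refine (ae_restrict_iff' hG.isOpen.measurableSet).2 ?_
    refine hG.isOpen.ae_eq_zero_of_integral_contDiff_smul_eq_zero
      (hc.continuousOn.locallyIntegrableOn hG.isOpen.measurableSet) fun φ hφ hφc hφs => ?_
    let φ' : Cn n → ℂ := fun z => (φ z : ℂ)
    have hφ' : ContDiff ℝ ∞ φ' := Complex.ofRealCLM.contDiff.comp hφ
    have hsupp : tsupport φ' ⊆ tsupport φ := closure_mono fun y hy h0 => hy (by simp [φ', h0])
    have hφ's : tsupport φ' ⊆ U := hsupp.trans hφs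
    have hφ'c : HasCompactSupport φ' := hφc.of_isClosed_subset (isClosed_tsupport _) hsupp
    -- The test form $\varphi\,d\bar z^l$ with `φ` real, so that conjugation does not affect it.
    let η : Cn n → Fin n → ℂ := fun z m => if m = l then φ' z else 0
    have hη : ContDiff ℝ ∞ η := contDiff_pi.2 fun m => by
      by_cases hm : m = l
      · simpa [η, hm] using hφ'
      · simpa [η, hm] using contDiff_const
    have hηsub : tsupport η ⊆ tsupport φ' := closure_mono fun y hy h0 => hy (by
      funext m; simp [η, h0])
    have hηc : HasCompactSupport η := hφ'c.of_isClosed_subset (isClosed_tsupport _) hηsub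
    have hin : ∀ (α : Cn n → Fin n → ℂ) (z : Cn n),
        inner01 G z (α z) (η z) * volDensity G z = f α l z * φ' z := by
      intro α z
      have : ∀ j, ∑ m, hInv G z m j * α z j * star (η z m) = hInv G z l j * α z j * φ' z := by
        intro j
        rw [Finset.sum_eq_single l]
        · simp [η, φ']
        · intro m _ hm; simp [η, hm]
        · simp
      simp only [inner01, this, f, ← Finset.sum_mul]
      ring
    have e := (h.2 η hη hηc (hηsub.trans hφ's)).trans (h'.2 η hη hηc (hηsub.trans hφ's)).symm
    simp only [hin] at e
    rw [setIntegral_eq_integral_of_forall_compl_eq_zero fun z hz => by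
        rw [eq_zero_of_notMem hφ's hz, mul_zero],
      setIntegral_eq_integral_of_forall_compl_eq_zero fun z hz => by
        rw [eq_zero_of_notMem hφ's hz, mul_zero]] at e
    have e' : (fun z => φ z • (f α l z - f α' l z))
        = fun z => f α l z * φ' z - f α' l z * φ' z := by
      funext z
      rw [Complex.real_smul]
      simp only [φ']
      ring
    rw [e', integral_sub (integrable_mul_of_tsupport_subset hG.isOpen (hf α h.1 l) hφ' hφ'c hφ's)
      (integrable_mul_of_tsupport_subset hG.isOpen (hf α' h'.1 l) hφ' hφ'c hφ's), e, sub_self]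
  intro z hz
  have hu := hG.isUnit_det z hz
  have hv : volDensity G z ≠ 0 := mul_ne_zero (pow_ne_zero _ two_ne_zero) hu.ne_zero
  have hz0 : (hMatrix G z)⁻¹ᵀ *ᵥ α z = (hMatrix G z)⁻¹ᵀ *ᵥ α' z := by
    funext l
    exact mul_right_cancel₀ hv (sub_eq_zero.1 (hfl l hz))
  have := congrArg (fun v => (hMatrix G z)ᵀ *ᵥ v) hz0
  simpa only [Matrix.mulVec_mulVec, ← Matrix.transpose_mul, Matrix.nonsing_inv_mul _ hu,
    Matrix.transpose_one, Matrix.one_mulVec] using this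

/-- The chosen adjoint is determined only on `U`; as `U` is open, this fixes its germ at `z` and
hence its derivative. -/
theorem del_delStar_omegaForm {z : Cn n} (hz : z ∈ U) :
    del (delStar U G (omegaForm G)) z = del (delStarOmega G) z := by
  have hex : ∃ α, IsDelStar U G (omegaForm G) α := ⟨_, hG.isDelStar_delStarOmega⟩
  have h : Set.EqOn (delStar U G (omegaForm G)) (delStarOmega G) U := by
    rw [delStar, dif_pos hex]
    exact hG.eqOn_of_isDelStar hex.choose_spec hG.isDelStar_delStarOmega
  ext i j
  simp only [del, Matrix.of_apply, dz_eq_wirtinger]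
  refine wirtinger_congr ?_
  filter_upwards [hG.isOpen.mem_nhds hz] with y hy
  rw [h hy]

theorem thetaOne_sub_del_delStar {z : Cn n} (hz : z ∈ U) :
    thetaOne G z - del (delStar U G (omegaForm G)) z = Complex.I • ricciMatrix G z := by
  rw [hG.del_delStar_omegaForm hz, hG.thetaOne_sub_del_delStarOmega hz]

end IsHermitianOn

end Adjoint

/-! ### The metric in a holomorphic chart -/

section Chart

variable {n : ℕ} {M : Type*} [TopologicalSpace M] [ChartedSpace (Cn n) M]
  [IsManifold 𝓘(ℂ, Cn n) ω M]

theorem contMDiffAt_chart_symm (x : M) {z : Cn n} (hz : z ∈ (chartAt (Cn n) x).target) :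
    ContMDiffAt 𝓘(ℝ, Cn n) 𝓘(ℝ, Cn n) ∞ (chartAt (Cn n) x).symm z :=
  contMDiffOn_chart_symm.contMDiffAt ((chartAt (Cn n) x).open_target.mem_nhds hz)

/-- The tangent space at each point is identified with $\mathbb C^n$ by the preferred chart at that
point, so the differential is that of a transition map. -/
theorem mfderiv_chart_symm_eq (x : M) {z : Cn n} (hz : z ∈ (chartAt (Cn n) x).target) :
    (mfderiv 𝓘(ℝ, Cn n) 𝓘(ℝ, Cn n) (chartAt (Cn n) x).symm z : Cn n →L[ℝ] Cn n)
      = fderiv ℝ (chartAt (Cn n) ((chartAt (Cn n) x).symm z) ∘ (chartAt (Cn n) x).symm) z := by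
  have h := (contMDiffAt_chart_symm x hz).mdifferentiableAt (by simp)
  refine Eq.trans (if_pos h) ?_
  change fderivWithin ℝ (writtenInExtChartAt 𝓘(ℝ, Cn n) 𝓘(ℝ, Cn n) z (chartAt (Cn n) x).symm)
    (Set.range 𝓘(ℝ, Cn n)) (extChartAt 𝓘(ℝ, Cn n) z z) = _
  simp only [writtenInExtChartAt, mfld_simps, fderivWithin_univ]
  rfl

theorem differentiableAt_chart_comp_chart_symm (x : M) {z : Cn n}
    (hz : z ∈ (chartAt (Cn n) x).target) :
    DifferentiableAt ℂ
      (chartAt (Cn n) ((chartAt (Cn n) x).symm z) ∘ (chartAt (Cn n) x).symm) z := by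
  have h : ContMDiffAt 𝓘(ℂ, Cn n) 𝓘(ℂ, Cn n) ω (chartAt (Cn n) x).symm z :=
    contMDiffOn_chart_symm.contMDiffAt ((chartAt (Cn n) x).open_target.mem_nhds hz)
  have h1 := (mdifferentiableAt_iff _ _).1 (h.mdifferentiableAt (by simp))
  have h2 := h1.2
  simp only [mfld_simps, differentiableWithinAt_univ] at h2
  exact h2

/-- The differential of the inverse of the chart at `x`, as a linear map of `ℂⁿ`. -/
def chartSymmDeriv (M : Type*) [TopologicalSpace M] [ChartedSpace (Cn n) M] (x : M) (z : Cn n) :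
    Cn n →L[ℝ] Cn n :=
  mfderiv 𝓘(ℝ, Cn n) 𝓘(ℝ, Cn n) (chartAt (Cn n) x).symm z

/-- Transition maps are holomorphic, so their real derivative is complex linear. This makes $J$
independent of the chart. -/
theorem chartSymmDeriv_I_smul (x : M) {z : Cn n} (hz : z ∈ (chartAt (Cn n) x).target) (v : Cn n) :
    chartSymmDeriv M x z (Complex.I • v) = Complex.I • chartSymmDeriv M x z v := by
  have h : ∀ v : Cn n, chartSymmDeriv M x z v
      = fderiv ℂ (chartAt (Cn n) ((chartAt (Cn n) x).symm z) ∘ (chartAt (Cn n) x).symm) z v := by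
    intro v
    have h1 := congrArg (fun T : Cn n →L[ℝ] Cn n => T v) (mfderiv_chart_symm_eq x hz)
    have h2 := (differentiableAt_chart_comp_chart_symm x hz).fderiv_restrictScalars ℝ
    rw [h2] at h1
    exact h1
  rw [h, h, map_smul]

theorem chartSymmDeriv_self (x : M) (v : Cn n) :
    chartSymmDeriv M x (chartAt (Cn n) x x) v = v := by
  have h1 := congrArg (fun T : Cn n →L[ℝ] Cn n => T v)
    (mfderiv_chart_symm_eq x (mem_chart_target (Cn n) x))
  refine h1.trans ?_
  have e : (chartAt (Cn n) x ∘ (chartAt (Cn n) x).symm : Cn n → Cn n)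
      =ᶠ[nhds (chartAt (Cn n) x x)] id := by
    filter_upwards [(chartAt (Cn n) x).open_target.mem_nhds (mem_chart_target (Cn n) x)] with y hy
    exact (chartAt (Cn n) x).right_inv hy
  change fderiv ℝ (chartAt (Cn n) ((chartAt (Cn n) x).symm (chartAt (Cn n) x x))
    ∘ (chartAt (Cn n) x).symm) (chartAt (Cn n) x x) v = v
  rw [(chartAt (Cn n) x).left_inv (mem_chart_source (Cn n) x), e.fderiv_eq, fderiv_id]
  rfl

theorem mfderiv_chart_symm_injective (x : M) {z : Cn n} (hz : z ∈ (chartAt (Cn n) x).target) :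
    Function.Injective (mfderiv 𝓘(ℝ, Cn n) 𝓘(ℝ, Cn n) (chartAt (Cn n) x).symm z) := by
  have h : (chartAt (Cn n) x).MDifferentiable 𝓘(ℝ, Cn n) 𝓘(ℝ, Cn n) :=
    mdifferentiable_chart x
  exact h.symm.mfderiv_injective hz

/-- Constant fields push forward to smooth fields along the inverse chart, and $g$ is a smooth
section evaluated on two of them. -/
theorem contDiffOn_chartMetric (g : SmoothMetric n M) (x : M) (v w : Cn n) :
    ContDiffOn ℝ ∞ (fun z => chartMetric g (chartAt (Cn n) x) z v w)
      (chartAt (Cn n) x).target := by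
  intro z hz
  have hb := contMDiffAt_chart_symm x hz
  have hv : ∀ v : Cn n, ContMDiffAt 𝓘(ℝ, Cn n) (𝓘(ℝ, Cn n).prod 𝓘(ℝ, Cn n)) ∞
      (fun y => TotalSpace.mk' (Cn n) (E := (TangentSpace 𝓘(ℝ, Cn n) : M → Type))
        ((chartAt (Cn n) x).symm y)
        (mfderiv 𝓘(ℝ, Cn n) 𝓘(ℝ, Cn n) (chartAt (Cn n) x).symm y v)) z := by
    intro v
    have hc : ContMDiffAt 𝓘(ℝ, Cn n) (𝓘(ℝ, Cn n).prod 𝓘(ℝ, Cn n)) ∞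
        (fun y => (⟨y, v⟩ : TangentBundle 𝓘(ℝ, Cn n) (Cn n))) z :=
      contMDiffAt_vectorSpace_iff_contDiffAt.2 contDiffAt_const
    exact ContMDiffAt.clm_apply_of_inCoordinates (hb.mfderiv_const (m := ∞) (by simp)) hc hb
  have h : ContMDiffAt 𝓘(ℝ, Cn n) (𝓘(ℝ, Cn n).prod 𝓘(ℝ)) ∞
      (fun y => TotalSpace.mk' ℝ (E := Bundle.Trivial M ℝ) ((chartAt (Cn n) x).symm y)
        (g.inner ((chartAt (Cn n) x).symm y)
          (mfderiv 𝓘(ℝ, Cn n) 𝓘(ℝ, Cn n) (chartAt (Cn n) x).symm y v)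
          (mfderiv 𝓘(ℝ, Cn n) 𝓘(ℝ, Cn n) (chartAt (Cn n) x).symm y w))) z := by
    apply ContMDiffAt.clm_bundle_apply₂ (F₁ := Cn n) (F₂ := Cn n)
    · exact ContMDiffAt.comp z g.contMDiff.contMDiffAt hb
    · exact hv v
    · exact hv w
  rw [contMDiffAt_totalSpace] at h
  exact h.2.contDiffAt.contDiffWithinAt

theorem isHermitianOn_chartMetric {g : SmoothMetric n M} (hg : IsHermitianMetric g) (x : M) :
    IsHermitianOn (chartAt (Cn n) x).target (chartMetric g (chartAt (Cn n) x)) where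
  isOpen := (chartAt (Cn n) x).open_target
  add_left z _ u v w := by
    refine (congrArg (fun a : Cn n => g.inner ((chartAt (Cn n) x).symm z) a
      (chartSymmDeriv M x z w)) (map_add (chartSymmDeriv M x z) u v)).trans ?_
    exact congrArg (fun T => T (chartSymmDeriv M x z w))
      (map_add (g.inner ((chartAt (Cn n) x).symm z)) _ _)
  smul_left z _ a v w := by
    refine (congrArg (fun a : Cn n => g.inner ((chartAt (Cn n) x).symm z) a
      (chartSymmDeriv M x z w)) (map_smul (chartSymmDeriv M x z) a v)).trans ?_
    exact congrArg (fun T => T (chartSymmDeriv M x z w))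
      (map_smul (g.inner ((chartAt (Cn n) x).symm z)) _ _)
  symm z _ v w := g.symm _ _ _
  rot z hz v w := by
    refine Eq.trans ?_ (hg ((chartAt (Cn n) x).symm z)
      (mfderiv 𝓘(ℝ, Cn n) 𝓘(ℝ, Cn n) (chartAt (Cn n) x).symm z v)
      (mfderiv 𝓘(ℝ, Cn n) 𝓘(ℝ, Cn n) (chartAt (Cn n) x).symm z w))
    exact congrArg₂ (fun a b : Cn n => g.inner ((chartAt (Cn n) x).symm z) a b)
      (chartSymmDeriv_I_smul x hz v) (chartSymmDeriv_I_smul x hz w)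
  pos z hz v hv := g.pos _ _ fun h0 => hv
    (mfderiv_chart_symm_injective x hz (h0.trans (map_zero _).symm))
  smooth v w := contDiffOn_chartMetric g x v w

theorem chartMetric_self (g : SmoothMetric n M) (x : M) (v w : Cn n) :
    chartMetric g (chartAt (Cn n) x) (chartAt (Cn n) x x) v w = g.inner x v w := by
  have h1 : chartMetric g (chartAt (Cn n) x) (chartAt (Cn n) x x) v w
      = (fun a b : Cn n => g.inner ((chartAt (Cn n) x).symm (chartAt (Cn n) x x)) a b) v w :=
    congrArg₂ (fun a b : Cn n => g.inner ((chartAt (Cn n) x).symm (chartAt (Cn n) x x)) a b)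
      (chartSymmDeriv_self x v) (chartSymmDeriv_self x w)
  -- A free base point lets the equality be substituted although the tangent space depends on it.
  have h2 : ∀ y : M, y = x → (fun a b : Cn n => g.inner y a b) v w = g.inner x v w := by
    rintro _ rfl; rfl
  exact h1.trans (h2 _ ((chartAt (Cn n) x).left_inv (mem_chart_source (Cn n) x)))

/-- The matrix `S_{i l̄} = h^{k j̄} Θ_{i j̄ k l̄}` at `x`, in the holomorphic chart at `x`. -/
def ricciMatrixAt (g : SmoothMetric n M) (x : M) : Matrix (Fin n) (Fin n) ℂ :=
  ricciMatrix (chartMetric g (chartAt (Cn n) x)) (chartAt (Cn n) x x)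

/-! ### Transfer to the manifold and the two equivalences -/

variable {g : SmoothMetric n M} (hg : IsHermitianMetric g)
include hg

theorem realChernRicci_eq (x : M) (X Y : Cn n) :
    realChernRicci g x X Y = sesqRe (ricciMatrixAt g x) X Y := by
  have hz := mem_chart_target (Cn n) x
  let b : Module.Basis (Fin (2 * n)) ℝ (Cn n) := orthonormalFrame g x
  have hb : ∀ a c, chartMetric g (chartAt (Cn n) x) (chartAt (Cn n) x x) (b a) (b c)
      = if a = c then 1 else 0 := fun a c => by
    rw [chartMetric_self]
    exact (exists_orthonormalFrame g x).choose_spec a c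
  rw [ricciMatrixAt, ← (isHermitianOn_chartMetric hg x).sum_metric_realChernCurvature hz b hb]
  simp only [chartMetric_self]
  rfl

theorem inner_eq_sesqRe (x : M) (X Y : Cn n) :
    g.inner x X Y
      = sesqRe (hMatrix (chartMetric g (chartAt (Cn n) x)) (chartAt (Cn n) x x)) X Y := by
  rw [← (isHermitianOn_chartMetric hg x).eq_sesqRe (mem_chart_target (Cn n) x), chartMetric_self]

theorem firstChernRicci_sub_delDelStarOmega (x : M) :
    firstChernRicci g x - delDelStarOmega g x = Complex.I • ricciMatrixAt g x :=
  (isHermitianOn_chartMetric hg x).thetaOne_sub_del_delStar (mem_chart_target (Cn n) x)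

theorem hasPositiveRealChernRicci_iff :
    HasPositiveRealChernRicci g ↔
      IsPositiveForm (fun x => firstChernRicci g x - delDelStarOmega g x) := by
  have h : ∀ x, -Complex.I • (firstChernRicci g x - delDelStarOmega g x) = ricciMatrixAt g x := by
    intro x
    rw [firstChernRicci_sub_delDelStarOmega hg, smul_smul]
    simp
  have e1 : HasPositiveRealChernRicci g ↔ ∀ x, (ricciMatrixAt g x).IsHermitian ∧
      ∀ X, X ≠ 0 → 0 < sesqRe (ricciMatrixAt g x) X X := by
    rw [forall_and]
    refine and_congr (forall_congr' fun x => ?_) (forall_congr' fun x => ?_)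
    · rw [← sesqRe_symm_iff]
      exact forall₂_congr fun X Y => Iff.of_eq (congrArg₂ (· = ·)
        (realChernRicci_eq hg x X Y) (realChernRicci_eq hg x Y X))
    · exact forall₂_congr fun X _ => Iff.of_eq (congrArg (0 < ·) (realChernRicci_eq hg x X X))
  rw [e1]
  exact forall_congr' fun x => by rw [h, posDef_iff_sesqRe]

theorem isRealChernEinstein_iff (lam : ℝ) :
    IsRealChernEinstein g lam ↔
      ∀ x, firstChernRicci g x - delDelStarOmega g x = (lam : ℂ) • fundamentalForm g x := by
  refine forall_congr' fun x => ?_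
  rw [firstChernRicci_sub_delDelStarOmega hg, fundamentalForm, omegaForm,
    smul_comm (lam : ℂ) Complex.I, smul_right_inj Complex.I_ne_zero, ← sesqRe_inj]
  exact forall₂_congr fun X Y => Iff.of_eq (congrArg₂ (· = ·) (realChernRicci_eq hg x X Y)
    ((congrArg (lam * ·) (inner_eq_sesqRe hg x X Y)).trans (sesqRe_smul lam _ X Y).symm))

end Chart

end HermitianGeometry

end

theorem mainTheorem10 {n : ℕ} {M : Type*} [TopologicalSpace M]
    [ChartedSpace (HermitianGeometry.Cn n) M]
    [IsManifold 𝓘(ℂ, HermitianGeometry.Cn n) ω M]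
    (g : HermitianGeometry.SmoothMetric n M) (hg : HermitianGeometry.IsHermitianMetric g) :
    (HermitianGeometry.HasPositiveRealChernRicci g ↔
      HermitianGeometry.IsPositiveForm
        (fun x => HermitianGeometry.firstChernRicci g x - HermitianGeometry.delDelStarOmega g x)) ∧
    ∀ lam : ℝ, HermitianGeometry.IsRealChernEinstein g lam ↔
      ∀ x, HermitianGeometry.firstChernRicci g x - HermitianGeometry.delDelStarOmega g x
        = (lam : ℂ) • HermitianGeometry.fundamentalForm g x :=
  ⟨HermitianGeometry.hasPositiveRealChernRicci_iff hg,
    HermitianGeometry.isRealChernEinstein_iff hg⟩
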